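/- **Setting.** Let $k\ge 1$ and let $M_k=\{e_1,\dots,e_k,f_1,\dots,f_k\}$ be a set of markers. Let $\mathcal M$ be a Markov chain with a finite set of states, initial state $s_{in}$, transition probabilities $\mathbf P(s,s')$, and an observation $\mathrm{Obs}(s)\subseteq M_k$ for every state $s$. A run is *good* if for some $i$ the marker $e_i$ is observed infinitely often and $f_i$ only finitely often. Let $P_{good}$ be the probability of the good runs from $s_{in}$; assume $P_{good}>0$. **Strategy.** At every step we may continue $\mathcal M$ (action $\mathsf c$) or restart it (action $\mathsf r$, which moves to $s_{in}$); only observations and past actions are known. A finite path $s_0\dots s_m$ has length $m$ and second half $s_{\lceil m/2\rceil}\dots s_m$. It is good if its length is $0$ or if for some $i$ it has a state with marker $e_i$ and no state with marker $f_i$. For $f:\mathbb N\to\mathbb N$, the strategy $\mathfrak S[f]$ works as follows. In the $n$-th attempt ($n=1,2,\dots$, i.e. after $n-1$ restarts) it samples the chain from $s_{in}$ in blocks of $2f(n)$ steps; after each block it restarts if the second half of the whole path sampled since the last restart is not good, and otherwise samples the next block. Let $S\in\mathbb N\cup\{\infty\}$ be the number of steps up to and including the last restart ($0$ if there is none, $\infty$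 if there are infinitely many). **Parameters.** The graph of $\mathcal M$ has an edge $s\to s'$ iff $\mathbf P(s,s')>0$. A bottom strongly connected component (BSCC) is $i$-good if it contains a state with marker $e_i$ and none with $f_i$; it is good if it is $i$-good for some $i$, and bad otherwise. Let $B_\gamma$ ($B_\beta$) be the set of states in good (bad) BSCCs and $S_\gamma$ ($S_\beta$) the set of states from which $B_\gamma$ ($B_\beta$) can be reached. A path of length at least $1$ is * a *good progress path* if it starts in $S_\gamma\setminus B_\gamma$ and ends in $B_\gamma$, or if it starts in an $i$-good BSCC and ends in a state with marker $e_i$, for some $i$; * a *bad progress path* if it starts in $S_\beta\setminus B_\beta$ and ends in $B_\beta$, or if it starts in a bad BSCC $B$ and, for every $i$ such that $e_i$ occurs in $B$, visits a state with marker $f_i$. Let $r_\gamma,R_\gamma,r_\beta,R_\beta$ be the maximum of the length of a shortest progress path from $s$ (good for $\gamma$, bad for $\beta$) over all $s$ in $S_\gamma\setminus B_\gamma$, $B_\gamma$, $S_\beta\setminus B_\beta$, $B_\beta$ respectively. Let $p_\gamma,P_\gamma,p_\beta,P_\beta$ be the minimum, over the same sets of states $s$, of the probability that the path of length $r_\gamma,R_\gamma,r_\beta,R_\beta$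 respectively sampled from $s$ contains such a progress path. The *progress radius* $R_m$ is the maximum of the four radii, and the *progress probability* $P_m$ the minimum of the four probabilities; those that range over an empty set of states are left out. **Corollary.** For every integer $c\ge 1$ there is a constant $C$, depending only on $c$, such that for all $k\ge1$ and all such chains $\mathcal M$ with $P_{good}>0$, if $\mathcal M$ is restarted according to $\mathfrak S[n\mapsto n^c]$ then $$\mathbb E[S]\;\le\; C\left(\left(\frac{R_m}{P_m}\right)^{1+1/c}+\frac1{P_{good}^{\,c+1}}\right).$$ -/

import Mathlib

open MeasureTheory ProbabilityTheory
open scoped ENNReal NNReal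

noncomputable section

namespace BlackBox

universe u v w

/-! ### Partially observable Markov chains -/

/-- A partially observable Markov chain with state space `S` and observations in `O`. Finiteness of
`S` is not part of the structure, because a strategy applied to a finite decision process induces
a chain with infinitely many states. -/
structure Chain (S : Type u) (O : Type v) where
  init : S
  obs : S → O
  trans : S → PMF S

namespace Chain

variable {S : Type u} {O : Type v}

/-- The law of the run of the chain started in state `s`: the unique probability measure on the
product space `ℕ → S` whose value on the cylinder of `s₀ s₁ … sₘ` is
`1_{s₀ = s} * ∏ P(sᵢ, sᵢ₊₁)`. -/
def runMeasure [MeasurableSpace S] [DiscreteMeasurableSpace S] (M : Chain S O) (s : S) :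
    Measure (ℕ → S) :=
  let step : (n : ℕ) → Kernel (Finset.Iic n → S) S := fun n =>
    { toFun := fun h => (M.trans (h ⟨n, Finset.mem_Iic.2 le_rfl⟩)).toMeasure
      measurable' :=
        (Measurable.of_discrete (f := fun t : S => (M.trans t).toMeasure)).comp
          (measurable_pi_apply _) }
  haveI : ∀ n, IsMarkovKernel (step n) := fun _ =>
    ⟨fun _ => PMF.toMeasure.isProbabilityMeasure _⟩
  Kernel.traj (X := fun _ => S) step 0 (fun _ => s)

/-- The edge relation of the graph of the chain. -/
def Edge (M : Chain S O) (s t : S) : Prop := 0 < M.trans s t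

def Reach (M : Chain S O) : S → S → Prop := Relation.ReflTransGen M.Edge

/-- `B` is the set of states of a bottom strongly connected component of the graph. -/
def IsBSCC (M : Chain S O) (B : Set S) : Prop :=
  B.Nonempty ∧ (∀ s ∈ B, ∀ t ∈ B, M.Reach s t) ∧ (∀ s ∈ B, ∀ t, M.Edge s t → t ∈ B)

/-- The states `ρ 0, …, ρ m` form a path of length `m`. A finite path of length `m` is represented
by any sequence that starts with its `m + 1` states. -/
def IsPath (M : Chain S O) (ρ : ℕ → S) (m : ℕ) : Prop := ∀ i < m, M.Edge (ρ i) (ρ (i + 1))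

end Chain

/-! ### Partially observable decision processes and strategies -/

/-- A Markov decision process with states `S`, observations in `O` and actions `A`. -/
structure MDP (S : Type u) (O : Type v) (A : Type w) where
  init : S
  obs : S → O
  trans : S → A → PMF S

/-- A strategy chooses the next action from the observations and actions so far:
a word of `(O × A)^* O` is given as its part in `(O × A)^*` and its last letter. -/
def Strategy (O : Type v) (A : Type w) : Type (max v w) := List (O × A) → O → A

/-- An element of `(S × A)^* × S`. -/
structure History (S : Type u) (A : Type w) where
  past : List (S × A)
  last : S

instance (S : Type u) (A : Type w) : MeasurableSpace (History S A) := ⊤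

instance (S : Type u) (A : Type w) : DiscreteMeasurableSpace (History S A) := ⟨fun _ => trivial⟩

/-- The Markov chain on histories induced by a strategy. -/
def MDP.induced {S : Type u} {O : Type v} {A : Type w}
    (D : MDP S O A) (σ : Strategy O A) : Chain (History S A) O where
  init := ⟨[], D.init⟩
  obs h := D.obs h.last
  trans h :=
    let a := σ (h.past.map fun p => (D.obs p.1, p.2)) (D.obs h.last)
    (D.trans h.last a).map fun t => ⟨h.past ++ [(h.last, a)], t⟩

/-- The two actions: restart and continue. -/
inductive Act : Type
  | restart
  | cont
  deriving DecidableEq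

/-- The restart decision process of a chain. -/
def Chain.restartMDP {S : Type u} {O : Type v} (M : Chain S O) : MDP S O Act where
  init := M.init
  obs := M.obs
  trans s a := match a with
    | Act.restart => PMF.pure M.init
    | Act.cont => M.trans s

/-- The action taken in step `n` of the run `ρ` (steps are numbered from `0`) is a restart. -/
def IsRestart {S : Type u} (ρ : ℕ → History S Act) (n : ℕ) : Prop :=
  ∃ s : S, (ρ (n + 1)).past.getLast? = some (s, Act.restart)

/-- The number of steps up to and including the last restart: `0` if there is no restart (supremum
of the empty set), and `∞` if there are infinitely many. -/
def stepsToLastRestart {S : Type u} (ρ : ℕ → History S Act) : ℝ≥0∞ :=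
  ⨆ (n : ℕ) (_ : IsRestart ρ n), ((n + 1 : ℕ) : ℝ≥0∞)

/-- The expected number of steps to the last restart if the chain `M` is restarted according
to `σ`. -/
def Chain.expectedSteps {S : Type u} {O : Type v} (M : Chain S O) (σ : Strategy O Act) : ℝ≥0∞ :=
  let N := M.restartMDP.induced σ
  ∫⁻ ρ, stepsToLastRestart ρ ∂(N.runMeasure N.init)

/-! ### Rabin languages and the strategies for them -/

/-- The markers `e₁, …, eₖ, f₁, …, fₖ`. -/
inductive Marker (k : ℕ) : Type
  | e (i : Fin k)
  | f (i : Fin k)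

/-- The Rabin language: some `eᵢ` occurs infinitely often while `fᵢ` occurs only finitely often. -/
def rabinLanguage (k : ℕ) : Set (ℕ → Set (Marker k)) :=
  {α | ∃ i : Fin k, {n | Marker.e i ∈ α n}.Infinite ∧ {n | Marker.f i ∈ α n}.Finite}

/-- A nonempty list of observations, seen along a finite path, is good. A path with a single state
has length `0`. -/
def GoodPath {k : ℕ} (l : List (Set (Marker k))) : Prop :=
  ∃ i : Fin k, l.length ≤ 1 ∨ ((∃ x ∈ l, Marker.e i ∈ x) ∧ ∀ x ∈ l, Marker.f i ∉ x)

/-- The second half `s_⌈m/2⌉ … s_m` of `s_0 … s_m`. The list has `m + 1` entries, and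
`⌈m/2⌉ = (m + 1) / 2` with rounding down. -/
def secondHalf {α : Type u} (l : List α) : List α := l.drop (l.length / 2)

/-- The observations made since the last restart, given the observations and actions so far. -/
def currentPath {O : Type v} (h : List (O × Act)) (x : O) : List O :=
  (h.rtakeWhile fun p => decide (p.2 = Act.cont)).map Prod.fst ++ [x]

open Classical in
/-- The strategy with parameter `f`. During the `n`-th attempt (`n = 1, 2, …`), that is, after
`n - 1` restarts, the chain is sampled in blocks of `2 * f n` steps. Whenever a block is complete
(also at the beginning of the attempt, where the path is still empty and hence good) it is checked
whether the second half of the path since the last restart is good; if it is not, the chain is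
restarted. -/
def rabinStrategy {k : ℕ} (f : ℕ → ℕ) : Strategy (Set (Marker k)) Act := fun h x =>
  let n := h.countP (fun p => decide (p.2 = Act.restart)) + 1
  let π := currentPath h x
  if 2 * f n ∣ π.length - 1 ∧ ¬ GoodPath (secondHalf π) then Act.restart else Act.cont

/-! ### Progress radius and progress probability -/

namespace Chain

variable {S : Type u} {k : ℕ}

/-- The probability of the good runs. -/
def probGood [MeasurableSpace S] [DiscreteMeasurableSpace S] (M : Chain S (Set (Marker k))) :
    ℝ≥0∞ :=
  M.runMeasure M.init {ρ | (fun n => M.obs (ρ n)) ∈ rabinLanguage k}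

/-- The set `B` of states contains `eᵢ` but not `fᵢ`. -/
def IsGoodFor (M : Chain S (Set (Marker k))) (i : Fin k) (B : Set S) : Prop :=
  (∃ s ∈ B, Marker.e i ∈ M.obs s) ∧ ∀ s ∈ B, Marker.f i ∉ M.obs s

/-- The states in good bottom strongly connected components. -/
def goodStates (M : Chain S (Set (Marker k))) : Set S :=
  {s | ∃ B, M.IsBSCC B ∧ s ∈ B ∧ ∃ i, M.IsGoodFor i B}

/-- The states in bad bottom strongly connected components. -/
def badStates (M : Chain S (Set (Marker k))) : Set S :=
  {s | ∃ B, M.IsBSCC B ∧ s ∈ B ∧ ¬ ∃ i, M.IsGoodFor i B}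

/-- The states from which a good bottom strongly connected component can be reached. -/
def goodReach (M : Chain S (Set (Marker k))) : Set S := {s | ∃ t ∈ M.goodStates, M.Reach s t}

/-- The states from which a bad bottom strongly connected component can be reached. -/
def badReach (M : Chain S (Set (Marker k))) : Set S := {s | ∃ t ∈ M.badStates, M.Reach s t}

/-- The path `ρ a, …, ρ b` is a good progress path. -/
def GoodProgress (M : Chain S (Set (Marker k))) (ρ : ℕ → S) (a b : ℕ) : Prop :=
  a < b ∧
    ((ρ a ∈ M.goodReach \ M.goodStates ∧ ρ b ∈ M.goodStates) ∨
      ∃ B i, M.IsBSCC B ∧ ρ a ∈ B ∧ M.IsGoodFor i B ∧ Marker.e i ∈ M.obs (ρ b))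

/-- The path `ρ a, …, ρ b` is a bad progress path. In a bad component `B` it has to visit,
for every `i` such that `eᵢ` occurs in `B`, a state with `fᵢ`; if no `eᵢ` occurs in `B` then every
non-empty path is a progress path. -/
def BadProgress (M : Chain S (Set (Marker k))) (ρ : ℕ → S) (a b : ℕ) : Prop :=
  a < b ∧
    ((ρ a ∈ M.badReach \ M.badStates ∧ ρ b ∈ M.badStates) ∨
      ∃ B, M.IsBSCC B ∧ (¬ ∃ i, M.IsGoodFor i B) ∧ ρ a ∈ B ∧
        ∀ i, (∃ s ∈ B, Marker.e i ∈ M.obs s) →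
          ∃ j, a ≤ j ∧ j ≤ b ∧ Marker.f i ∈ M.obs (ρ j))

/-- The length of a shortest path from `s` that is a progress path in the sense of `prog`. -/
def shortest (M : Chain S (Set (Marker k))) (prog : (ℕ → S) → ℕ → ℕ → Prop) (s : S) : ℕ :=
  sInf {m | ∃ ρ : ℕ → S, ρ 0 = s ∧ M.IsPath ρ m ∧ prog ρ 0 m}

open Classical in
/-- The maximum over `s ∈ T` of the length of a shortest progress path from `s`. It is `0`, and so
has no influence on the progress radius, if `T` is empty. -/
def radius [Fintype S] (M : Chain S (Set (Marker k))) (prog : (ℕ → S) → ℕ → ℕ → Prop)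
    (T : Set S) : ℕ :=
  (Finset.univ.filter (· ∈ T)).sup (M.shortest prog)

/-- The minimum over `s ∈ T` of the probability that a path of length `r` from `s` contains a
progress path. It is `∞`, and so has no influence on the progress probability, if `T` is empty. -/
def minProb [MeasurableSpace S] [DiscreteMeasurableSpace S] (M : Chain S (Set (Marker k)))
    (prog : (ℕ → S) → ℕ → ℕ → Prop) (T : Set S) (r : ℕ) : ℝ≥0∞ :=
  ⨅ s ∈ T, M.runMeasure s {ρ | ∃ a b, b ≤ r ∧ prog ρ a b}

section parameters

variable [Fintype S] (M : Chain S (Set (Marker k)))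

def goodReachRadius : ℕ := M.radius M.GoodProgress (M.goodReach \ M.goodStates)

def goodWitnessRadius : ℕ := M.radius M.GoodProgress M.goodStates

def badReachRadius : ℕ := M.radius M.BadProgress (M.badReach \ M.badStates)

def badWitnessRadius : ℕ := M.radius M.BadProgress M.badStates

/-- The progress radius `R_m`. -/
def progressRadius : ℕ :=
  max (max M.goodReachRadius M.goodWitnessRadius) (max M.badReachRadius M.badWitnessRadius)

variable [MeasurableSpace S] [DiscreteMeasurableSpace S]

def goodReachProb : ℝ≥0∞ :=
  M.minProb M.GoodProgress (M.goodReach \ M.goodStates) M.goodReachRadius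

def goodWitnessProb : ℝ≥0∞ := M.minProb M.GoodProgress M.goodStates M.goodWitnessRadius

def badReachProb : ℝ≥0∞ :=
  M.minProb M.BadProgress (M.badReach \ M.badStates) M.badReachRadius

def badWitnessProb : ℝ≥0∞ := M.minProb M.BadProgress M.badStates M.badWitnessRadius

/-- The progress probability `P_m`. -/
def progressProb : ℝ≥0∞ :=
  min (min M.goodReachProb M.goodWitnessProb) (min M.badReachProb M.badWitnessProb)

end parameters

end Chain

end BlackBox

end

namespace BlackBox

universe u v

/-! Write `R`, `P`, `G` for the progress radius, the progress probability and the probability of the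
good runs, and `K = R / P`. If `P = 0`, the right-hand side is infinite because `R ≥ 1`. Otherwise
the expected time to the last restart is bounded by a sum over attempts: the expected length of each
attempt, counted only if it ends, weighted by a bound for the probability that all earlier ones end
(`expectedSteps_le_tsum`). What remains concerns a single run of `M`, checked in blocks of `2m`
steps, where `m = n ^ c`.

Both estimates rest on one notion. A run is stuck on an interval if it stays in `S_γ` (or `S_β`) and
makes no good (or bad) progress there. By the Markov property, being stuck for `h` steps has
probability at most `(1 - P) ^ ⌊h / R⌋` (`runMeasure_stuck_le`), roughly `exp (-h / K)`.

Length: if a late check fails, an earlier check at a comparable time had succeeded, and a good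
window followed by a bad one forces the run to be stuck for a comparable time
(`stuck_of_goodWindow_of_not_goodWindow`). Summing over dyadic scales, the expected length is `O(m +
K)`.

Survival: if `m ≥ 4K`, the run is in a good component at time `m` with probability at least `G / 2`,
and from there all checks succeed with probability at least `1 / 2` (`runMeasure_rabinRule_le`). The
error terms are proportional to the probabilities being estimated, so the required `m` does not
depend on `G`.

Summation: let `L` be about `(4K) ^ (1 / c)`. The attempts below `L` contribute `O(L ^ (c + 1))`,
that is `O(K ^ (1 + 1 / c))`; the later ones end with probability at most `1 - G / 4` and contribute
`O(L ^ c / G + 1 / G ^ (c + 1))`, where the mixed term is absorbed by the other two powers. -/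

/-- The sequence `s, ω 0, ω 1, …`. -/
def consSeq {S : Type u} (s : S) (ω : ℕ → S) : ℕ → S
  | 0 => s
  | n + 1 => ω n

@[simp] lemma consSeq_zero {S : Type u} (s : S) (ω : ℕ → S) : consSeq s ω 0 = s := rfl

@[simp] lemma consSeq_succ {S : Type u} (s : S) (ω : ℕ → S) (n : ℕ) :
    consSeq s ω (n + 1) = ω n := rfl

lemma measurable_consSeq {S : Type u} [MeasurableSpace S] (s : S) :
    Measurable (consSeq s : (ℕ → S) → ℕ → S) := by
  refine measurable_pi_lambda _ fun n => ?_
  cases n with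
  | zero => exact measurable_const
  | succ n => exact measurable_pi_apply n

/-- A set of sequences that is determined by the first coordinates is measurable. -/
lemma measurableSet_of_forall_le {S : Type u} [Countable S] [MeasurableSpace S]
    [DiscreteMeasurableSpace S] {A : Set (ℕ → S)} (n : ℕ)
    (hA : ∀ ω ω' : ℕ → S, (∀ i ≤ n, ω i = ω' i) → ω ∈ A → ω' ∈ A) : MeasurableSet A := by
  have : A = (fun ω (i : Fin (n + 1)) => ω i) ⁻¹' ((fun ω (i : Fin (n + 1)) => ω i) '' A) := by
    ext ω
    refine ⟨fun h => ⟨ω, h, rfl⟩, ?_⟩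
    rintro ⟨ω', h, he⟩
    exact hA ω' ω (fun i hi => congrFun he ⟨i, by omega⟩) h
  rw [this]
  exact (measurable_pi_lambda _ fun i => measurable_pi_apply _) (MeasurableSet.of_discrete)

/-! ### The law of a run: cylinders, first step analysis, Markov property -/

namespace Chain

variable {S : Type u} {O : Type v} [MeasurableSpace S] [DiscreteMeasurableSpace S]

/-- The transition kernels of the chain, as used by the Ionescu-Tulcea theorem. -/
noncomputable def stepKernel (M : Chain S O) (n : ℕ) : Kernel (Finset.Iic n → S) S where
  toFun := fun h => (M.trans (h ⟨n, Finset.mem_Iic.2 le_rfl⟩)).toMeasure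
  measurable' :=
        (Measurable.of_discrete (f := fun t : S => (M.trans t).toMeasure)).comp
          (measurable_pi_apply _)

instance (M : Chain S O) (n : ℕ) : IsMarkovKernel (M.stepKernel n) :=
  ⟨fun _ => PMF.toMeasure.isProbabilityMeasure _⟩

lemma runMeasure_eq_traj (M : Chain S O) (s : S) :
    M.runMeasure s = Kernel.traj (X := fun _ => S) M.stepKernel 0 (fun _ => s) := rfl

instance (M : Chain S O) (s : S) : IsProbabilityMeasure (M.runMeasure s) := by
  rw [runMeasure_eq_traj]; infer_instance

/-- The sequences that agree with `z` up to time `n`. -/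
def cyl {S : Type u} (n : ℕ) (z : ℕ → S) : Set (ℕ → S) := {ω | ∀ i ≤ n, ω i = z i}

lemma measurableSet_cyl [Countable S] (n : ℕ) (z : ℕ → S) : MeasurableSet (cyl n z) :=
  measurableSet_of_forall_le n fun _ _ h hω i hi => (h i hi).symm.trans (hω i hi)

lemma cyl_eq_preimage {S : Type u} (n : ℕ) (z : ℕ → S) :
    cyl n z = Preorder.frestrictLe (π := fun _ => S) n ⁻¹' {Preorder.frestrictLe n z} := by
  ext ω
  simp only [cyl, Set.mem_ofPred_eq, Set.mem_preimage, Set.mem_singleton_iff, funext_iff,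
    Preorder.frestrictLe_apply, Subtype.forall, Finset.mem_Iic]

lemma runMeasure_cyl_zero [Countable S] (M : Chain S O) (s : S) (z : ℕ → S) :
    M.runMeasure s (cyl 0 z) = ({s} : Set S).indicator 1 (z 0) := by
  classical
  rw [runMeasure_eq_traj, cyl_eq_preimage,
    ← Measure.map_apply (Preorder.measurable_frestrictLe 0) (MeasurableSet.of_discrete),
    Kernel.traj_map_frestrictLe_apply, Kernel.partialTraj_self, Kernel.id_apply,
    Measure.dirac_apply]
  simp only [Set.indicator, Set.mem_singleton_iff, funext_iff, Preorder.frestrictLe_apply,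
    Subtype.forall, Finset.mem_Iic, Pi.one_apply]
  refine if_congr ⟨fun h => (h 0 le_rfl).symm, fun h i hi => ?_⟩ rfl rfl
  obtain rfl : i = 0 := by omega
  exact h.symm

lemma runMeasure_cyl_succ [Countable S] (M : Chain S O) (s : S) (z : ℕ → S) (n : ℕ) :
    M.runMeasure s (cyl (n + 1) z) = M.runMeasure s (cyl n z) * M.trans (z n) (z (n + 1)) := by
  classical
  rw [runMeasure_eq_traj, cyl_eq_preimage, cyl_eq_preimage,
    ← Measure.map_apply (Preorder.measurable_frestrictLe _) (MeasurableSet.of_discrete),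
    ← Measure.map_apply (Preorder.measurable_frestrictLe _) (MeasurableSet.of_discrete),
    Kernel.traj_map_frestrictLe_apply, Kernel.traj_map_frestrictLe_apply,
    Kernel.partialTraj_succ_of_le (Nat.zero_le n), Kernel.map_apply' _ (by fun_prop) _
      (MeasurableSet.of_discrete), Kernel.comp_apply' _ _ _ ((by fun_prop : Measurable
        (IicProdIoc (X := fun _ => S) n (n + 1))) MeasurableSet.of_discrete)]
  have hpre : IicProdIoc (X := fun _ => S) n (n + 1) ⁻¹' {Preorder.frestrictLe (n + 1) z} =
      {Preorder.frestrictLe n z} ×ˢ {fun i : Finset.Ioc n (n + 1) => z i} := by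
    ext ⟨x, y⟩
    simp only [Set.mem_preimage, Set.mem_singleton_iff, Set.mem_prod, funext_iff, IicProdIoc_def,
      Preorder.frestrictLe_apply, Subtype.forall, Finset.mem_Iic, Finset.mem_Ioc]
    refine ⟨fun h => ⟨fun i hi => ?_, fun i hi => ?_⟩, fun ⟨h₁, h₂⟩ i hi => ?_⟩
    · simpa [hi] using h i (by omega)
    · simpa [not_le.2 hi.1] using h i hi.2
    · split_ifs with h
      · exact h₁ i h
      · exact h₂ i ⟨by omega, hi⟩
  have hstep (x : Finset.Iic n → S) : (M.stepKernel n).map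
      (MeasurableEquiv.piSingleton (X := fun _ => S) n) x {fun i : Finset.Ioc n (n + 1) => z i} =
      M.trans (x ⟨n, Finset.mem_Iic.2 le_rfl⟩) (z (n + 1)) := by
    rw [Kernel.map_apply' _ (MeasurableEquiv.measurable _) _ MeasurableSet.of_discrete]
    have : (MeasurableEquiv.piSingleton (X := fun _ => S) n) ⁻¹'
        {fun i : Finset.Ioc n (n + 1) => z i} = {z (n + 1)} := by
      ext t
      rw [Set.mem_preimage, Set.mem_singleton_iff, Set.mem_singleton_iff,
        ← MeasurableEquiv.eq_symm_apply]
      rfl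
    rw [this]
    exact PMF.toMeasure_apply_singleton _ _ MeasurableSet.of_discrete
  have hval (x : Finset.Iic n → S) : (Kernel.id ×ₖ (M.stepKernel n).map
      (MeasurableEquiv.piSingleton (X := fun _ => S) n)) x
        ({Preorder.frestrictLe n z} ×ˢ {fun i : Finset.Ioc n (n + 1) => z i}) =
      ({Preorder.frestrictLe n z} : Set (Finset.Iic n → S)).indicator
        (fun _ => M.trans (z n) (z (n + 1))) x := by
    have := Kernel.IsMarkovKernel.map (M.stepKernel n)
      (MeasurableEquiv.piSingleton (X := fun _ => S) n).measurable
    rw [Kernel.prod_apply, Measure.prod_prod, hstep, Kernel.id_apply, Measure.dirac_apply]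
    by_cases h : x = Preorder.frestrictLe n z
    · subst h
      simp
    · simp [h]
  rw [hpre]
  simp_rw [hval]
  rw [lintegral_indicator_const MeasurableSet.of_discrete, mul_comm]

/-- As `S` is countable, the law of finitely many coordinates is determined by its values on
singletons, and the measurable cylinders form a generating π-system. -/
lemma ext_of_cyl [Countable S] {μ ν : Measure (ℕ → S)} [IsFiniteMeasure μ]
    (h : ∀ n z, μ (cyl n z) = ν (cyl n z)) : μ = ν := by
  have hmap (n : ℕ) : μ.map (Preorder.frestrictLe (π := fun _ => S) n) =
      ν.map (Preorder.frestrictLe n) := by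
    refine Measure.ext_of_singleton fun w => ?_
    obtain ⟨z, rfl⟩ : ∃ z : ℕ → S, Preorder.frestrictLe (π := fun _ => S) n z = w :=
      ⟨fun i => w ⟨min i n, Finset.mem_Iic.2 (min_le_right _ _)⟩, by
        ext ⟨i, hi⟩
        simp only [Preorder.frestrictLe_apply]
        congr 2
        exact min_eq_left (Finset.mem_Iic.1 hi)⟩
    rw [Measure.map_apply (Preorder.measurable_frestrictLe _) MeasurableSet.of_discrete,
      Measure.map_apply (Preorder.measurable_frestrictLe _) MeasurableSet.of_discrete,
      ← cyl_eq_preimage, h]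
  have hcyl (t : Set (ℕ → S)) (ht : t ∈ measurableCylinders (fun _ : ℕ => S)) : μ t = ν t := by
    obtain ⟨a, A, hA, rfl⟩ : ∃ a A, MeasurableSet A ∧ t = cylinder (Finset.Iic a) A := by
      simpa [measurableCylinders_nat] using ht
    have := congrArg (fun ρ => ρ A) (hmap a)
    rwa [Measure.map_apply (Preorder.measurable_frestrictLe _) hA,
      Measure.map_apply (Preorder.measurable_frestrictLe _) hA] at this
  refine ext_of_generate_finite _ generateFrom_measurableCylinders.symm
    isPiSystem_measurableCylinders hcyl ?_
  have := congrArg (fun ρ => ρ Set.univ) (hmap 0)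
  simpa only [Measure.map_apply (Preorder.measurable_frestrictLe _) MeasurableSet.univ,
    Set.preimage_univ] using this

lemma runMeasure_cyl_succ' [Countable S] (M : Chain S O) (z : ℕ → S) (n : ℕ) :
    M.runMeasure (z 0) (cyl (n + 1) z) =
      M.trans (z 0) (z 1) * M.runMeasure (z 1) (cyl n fun i => z (i + 1)) := by
  induction n with
  | zero => simp [runMeasure_cyl_succ, runMeasure_cyl_zero]
  | succ n ih => rw [runMeasure_cyl_succ, ih, runMeasure_cyl_succ, mul_assoc]

/-- First step analysis: the law of a run in terms of the laws of the runs from the successors. -/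
lemma runMeasure_eq_sum [Countable S] (M : Chain S O) (s : S) :
    M.runMeasure s = Measure.sum fun t => M.trans s t • (M.runMeasure t).map (consSeq s) := by
  classical
  refine ext_of_cyl fun n z => ?_
  rw [Measure.sum_apply _ (measurableSet_cyl n z)]
  simp only [Measure.smul_apply, smul_eq_mul,
    Measure.map_apply (measurable_consSeq s) (measurableSet_cyl n z)]
  have hzero (t : S) : M.runMeasure t (cyl 0 z) = ({t} : Set S).indicator 1 (z 0) :=
    M.runMeasure_cyl_zero t z
  by_cases hz : z 0 = s
  · subst hz
    cases n with
    | zero =>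
      have : consSeq (z 0) ⁻¹' cyl 0 z = Set.univ := by
        ext ω; simp [cyl]
      simp [this, hzero, PMF.tsum_coe]
    | succ n =>
      have : consSeq (z 0) ⁻¹' cyl (n + 1) z = cyl n fun i => z (i + 1) := by
        ext ω
        refine ⟨fun h i hi => h (i + 1) (by omega), fun h i hi => ?_⟩
        cases i with
        | zero => rfl
        | succ i => exact h i (by omega)
      -- A run from `t ≠ z 1` almost surely misses the shifted cylinder, so a single successor
      -- contributes.
      rw [this, runMeasure_cyl_succ', tsum_eq_single (z 1)]
      intro t ht
      have h0 : M.runMeasure t (cyl n fun i => z (i + 1)) = 0 := by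
        refine measure_mono_null (t := cyl 0 fun i => z (i + 1))
          (fun ω hω i hi => hω i (by omega)) ?_
        rw [runMeasure_cyl_zero]
        simp [Ne.symm ht]
      rw [h0, mul_zero]
  · have h1 : consSeq s ⁻¹' cyl n z = ∅ := by
      ext ω
      simp only [Set.mem_preimage, Set.mem_empty_iff_false, iff_false]
      exact fun h => hz (h 0 (by omega)).symm
    have h2 : M.runMeasure s (cyl n z) = 0 := by
      refine measure_mono_null (t := cyl 0 z) (fun ω hω i hi => hω i (by omega)) ?_
      rw [hzero]
      simp [hz]
    simp [h1, h2]

lemma runMeasure_apply_eq_tsum [Countable S] (M : Chain S O) (s : S) {A : Set (ℕ → S)}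
    (hA : MeasurableSet A) :
    M.runMeasure s A = ∑' t, M.trans s t * M.runMeasure t (consSeq s ⁻¹' A) := by
  conv_lhs => rw [runMeasure_eq_sum, Measure.sum_apply _ hA]
  simp only [Measure.smul_apply, smul_eq_mul, Measure.map_apply (measurable_consSeq s) hA]

lemma lintegral_runMeasure_eq_tsum [Countable S] (M : Chain S O) (s : S) {F : (ℕ → S) → ℝ≥0∞}
    (hF : Measurable F) :
    ∫⁻ ω, F ω ∂M.runMeasure s = ∑' t, M.trans s t * ∫⁻ ω, F (consSeq s ω) ∂M.runMeasure t := by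
  conv_lhs => rw [runMeasure_eq_sum, lintegral_sum_measure]
  simp only [lintegral_smul_measure, smul_eq_mul, lintegral_map hF (measurable_consSeq s)]

lemma ae_zero_eq [Countable S] (M : Chain S O) (s : S) : ∀ᵐ ω ∂M.runMeasure s, ω 0 = s := by
  have h : M.runMeasure s (cyl 0 fun _ => s) = 1 := by simp [runMeasure_cyl_zero]
  have := (prob_compl_eq_zero_iff (measurableSet_cyl 0 fun _ : ℕ => s)).2 h
  filter_upwards [compl_mem_ae_iff.2 this] with ω hω
  exact not_not.1 hω 0 le_rfl

lemma ae_edge [Countable S] (M : Chain S O) (s : S) :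
    ∀ᵐ ω ∂M.runMeasure s, ∀ n, M.Edge (ω n) (ω (n + 1)) := by
  rw [ae_all_iff]
  intro n
  have hm (n : ℕ) : MeasurableSet {ω : ℕ → S | ¬ M.Edge (ω n) (ω (n + 1))} :=
    measurableSet_of_forall_le (n + 1) fun ω ω' h hω => by
      simpa only [Set.mem_ofPred_eq, ← h n (by omega), ← h (n + 1) le_rfl] using hω
  rw [ae_iff]
  induction n generalizing s with
  | zero =>
    rw [runMeasure_apply_eq_tsum _ _ (hm 0), ENNReal.tsum_eq_zero]
    intro t
    by_cases ht : M.trans s t = 0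
    · simp [ht]
    · rw [mul_eq_zero]
      right
      have := M.ae_zero_eq t
      rw [ae_iff] at this
      refine measure_mono_null (fun ω hω => ?_) this
      intro h
      refine hω ?_
      simpa [Edge, h] using pos_iff_ne_zero.2 ht
  | succ n ih =>
    rw [runMeasure_apply_eq_tsum _ _ (hm _), ENNReal.tsum_eq_zero]
    intro t
    rw [mul_eq_zero]
    exact Or.inr (ih t)

/-- A consequence of the Markov property at time `m`. -/
lemma runMeasure_inter_shift_le [Countable S] (M : Chain S O) (m : ℕ) (s : S) {D : Set S}
    {A E : Set (ℕ → S)} (hA : ∀ ω ω' : ℕ → S, (∀ i ≤ m, ω i = ω' i) → ω ∈ A → ω' ∈ A)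
    (hD : ∀ ω ∈ A, ω m ∈ D) (hE : MeasurableSet E) {c : ℝ≥0∞}
    (hc : ∀ t ∈ D, M.runMeasure t E ≤ c) :
    M.runMeasure s (A ∩ {ω | (fun i => ω (m + i)) ∈ E}) ≤ c * M.runMeasure s A := by
  induction m generalizing s A with
  | zero =>
    simp only [zero_add]
    -- Here `A` depends on `ω 0` only, which is almost surely `s`, so `A` has probability `1` or
    -- `0`.
    by_cases h : (fun _ => s) ∈ A
    · have h1 : M.runMeasure s A = 1 := by
        rw [← measure_univ (μ := M.runMeasure s)]
        refine measure_congr ?_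
        filter_upwards [M.ae_zero_eq s] with ω hω
        refine eq_iff_iff.2 ⟨fun _ => trivial, fun _ => ?_⟩
        exact hA (fun _ => s) ω (fun i hi => by rw [Nat.le_zero.1 hi, hω]) h
      rw [h1, mul_one]
      exact (measure_mono Set.inter_subset_right).trans (hc s (hD _ h))
    · have : M.runMeasure s (A ∩ {ω | ω ∈ E}) = 0 := by
        have := M.ae_zero_eq s
        rw [ae_iff] at this
        refine measure_mono_null (fun ω hω => ?_) this
        exact fun h0 : ω 0 = s => h (hA ω _ (fun i hi => by rw [Nat.le_zero.1 hi, h0]) hω.1)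
      rw [this]
      exact zero_le
  | succ m ih =>
    have hshift : MeasurableSet {ω : ℕ → S | (fun i => ω (m + 1 + i)) ∈ E} :=
      (measurable_pi_lambda _ fun i => measurable_pi_apply (m + 1 + i)) hE
    have hAm := measurableSet_of_forall_le (m + 1) hA
    rw [runMeasure_apply_eq_tsum _ _ (hAm.inter hshift), runMeasure_apply_eq_tsum _ _ hAm,
      ← ENNReal.tsum_mul_left]
    refine ENNReal.tsum_le_tsum fun t => ?_
    rw [mul_left_comm]
    gcongr
    have : consSeq s ⁻¹' (A ∩ {ω | (fun i => ω (m + 1 + i)) ∈ E}) =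
        consSeq s ⁻¹' A ∩ {ω | (fun i => ω (m + i)) ∈ E} := by
      ext ω
      have : (fun i => consSeq s ω (m + 1 + i)) = fun i => ω (m + i) := by
        ext i
        rw [add_right_comm]
        rfl
      simp [this]
    rw [this]
    refine ih t (fun ω ω' h hω => ?_) (fun ω hω => ?_)
    · refine hA (consSeq s ω) _ (fun i hi => ?_) hω
      cases i with
      | zero => rfl
      | succ i => exact h i (by omega)
    · exact hD (consSeq s ω) hω

end Chain

/-! ### Stopping rules on paths and the expected cost of one attempt -/

/-- The states visited up to time `t`. -/
def prefixList {S : Type u} (ω : ℕ → S) (t : ℕ) : List S := (List.range (t + 1)).map ω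

lemma prefixList_zero {S : Type u} (ω : ℕ → S) : prefixList ω 0 = [ω 0] := rfl

lemma prefixList_consSeq_succ {S : Type u} (s : S) (ω : ℕ → S) (t : ℕ) :
    prefixList (consSeq s ω) (t + 1) = s :: prefixList ω t := by
  simp [prefixList, List.range_succ_eq_map, Function.comp_def]

lemma prefixList_congr {S : Type u} {ω ω' : ℕ → S} {t : ℕ} (h : ∀ i ≤ t, ω i = ω' i) :
    prefixList ω t = prefixList ω' t :=
  List.map_congr_left fun i hi => h i (by simpa [Nat.lt_succ_iff] using hi)

/-- Time `t` is the first time at which the stopping rule `d` applies to the path that consists of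
`pre` and the states of `ω` seen so far. -/
def FirstStop {S : Type u} (d : List S → Prop) (pre : List S) (ω : ℕ → S) (t : ℕ) : Prop :=
  d (pre ++ prefixList ω t) ∧ ∀ u < t, ¬ d (pre ++ prefixList ω u)

lemma FirstStop.unique {S : Type u} {d : List S → Prop} {pre : List S} {ω : ℕ → S} {t u : ℕ}
    (ht : FirstStop d pre ω t) (hu : FirstStop d pre ω u) : t = u := by
  rcases lt_trichotomy t u with h | h | h
  · exact absurd ht.1 (hu.2 t h)
  · exact h
  · exact absurd hu.1 (ht.2 u h)

lemma FirstStop.congr {S : Type u} {d : List S → Prop} {pre : List S} {ω ω' : ℕ → S} {t : ℕ}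
    (h : ∀ i ≤ t, ω i = ω' i) (ht : FirstStop d pre ω t) : FirstStop d pre ω' t := by
  refine ⟨prefixList_congr h ▸ ht.1, fun u hu => ?_⟩
  rw [← prefixList_congr fun i hi => h i (by omega)]
  exact ht.2 u hu

lemma firstStop_consSeq_zero {S : Type u} {d : List S → Prop} {pre : List S} {s : S}
    {ω : ℕ → S} : FirstStop d pre (consSeq s ω) 0 ↔ d (pre ++ [s]) := by
  simp [FirstStop, prefixList_zero]

lemma firstStop_consSeq_succ {S : Type u} {d : List S → Prop} {pre : List S} {s : S}
    {ω : ℕ → S} {t : ℕ} : FirstStop d pre (consSeq s ω) (t + 1) ↔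
      ¬ d (pre ++ [s]) ∧ FirstStop d (pre ++ [s]) ω t := by
  simp only [FirstStop, prefixList_consSeq_succ, List.append_assoc, List.singleton_append]
  constructor
  · rintro ⟨h₁, h₂⟩
    refine ⟨by simpa [prefixList_zero] using h₂ 0 (by omega), h₁, fun u hu => ?_⟩
    simpa only [prefixList_consSeq_succ] using h₂ (u + 1) (by omega)
  · rintro ⟨h₀, h₁, h₂⟩
    refine ⟨h₁, fun u hu => ?_⟩
    cases u with
    | zero => simpa [prefixList_zero] using h₀
    | succ u => simpa only [prefixList_consSeq_succ] using h₂ u (by omega)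

open Classical in
/-- The length of the path when the rule `d` applies for the first time, plus `w`; it is `0` if the
rule never applies. -/
noncomputable def stopCost {S : Type u} (d : List S → Prop) (w : ℝ≥0∞) (pre : List S)
    (ω : ℕ → S) : ℝ≥0∞ :=
  ∑' t, if FirstStop d pre ω t then ((pre.length + (t + 1) : ℕ) : ℝ≥0∞) + w else 0

lemma stopCost_of_firstStop {S : Type u} {d : List S → Prop} {w : ℝ≥0∞} {pre : List S}
    {ω : ℕ → S} {t : ℕ} (ht : FirstStop d pre ω t) :
    stopCost d w pre ω = ((pre.length + (t + 1) : ℕ) : ℝ≥0∞) + w := by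
  classical
  rw [stopCost, tsum_eq_single t, if_pos ht]
  intro u hu
  exact if_neg fun h => hu (h.unique ht)

lemma stopCost_of_forall_not {S : Type u} {d : List S → Prop} {w : ℝ≥0∞} {pre : List S}
    {ω : ℕ → S} (h : ∀ t, ¬ FirstStop d pre ω t) : stopCost d w pre ω = 0 := by
  simp [stopCost, h]

lemma stopCost_consSeq {S : Type u} {d : List S → Prop} {w : ℝ≥0∞} {pre : List S} {s : S}
    (hs : ¬ d (pre ++ [s])) (ω : ℕ → S) :
    stopCost d w pre (consSeq s ω) = stopCost d w (pre ++ [s]) ω := by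
  classical
  rw [stopCost, tsum_eq_zero_add' ENNReal.summable, if_neg (by rwa [firstStop_consSeq_zero]),
    zero_add]
  refine tsum_congr fun t => ?_
  refine if_congr (by simp [firstStop_consSeq_succ, hs]) ?_ rfl
  congr 2
  simp only [List.length_append, List.length_singleton]
  omega

lemma measurable_stopCost {S : Type u} [Countable S] [MeasurableSpace S]
    [DiscreteMeasurableSpace S] (d : List S → Prop) (w : ℝ≥0∞) (pre : List S) :
    Measurable (stopCost d w pre) := by
  classical
  refine Measurable.tsum fun t => Measurable.ite ?_ measurable_const measurable_const
  exact measurableSet_of_forall_le t fun _ _ h hω => hω.congr h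

namespace Chain

variable {S : Type u} {O : Type v} [MeasurableSpace S] [DiscreteMeasurableSpace S]

/-- The expected value of `stopCost` if the path `pre` is continued from `x`. -/
noncomputable def stopValue (M : Chain S O) (d : List S → Prop) (w : ℝ≥0∞) (pre : List S)
    (x : S) : ℝ≥0∞ :=
  ∫⁻ ω, stopCost d w pre ω ∂M.runMeasure x

lemma stopValue_of_stop [Countable S] (M : Chain S O) {d : List S → Prop} {w : ℝ≥0∞}
    {pre : List S} {x : S} (hx : d (pre ++ [x])) :
    M.stopValue d w pre x = ((pre.length + 1 : ℕ) : ℝ≥0∞) + w := by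
  have : stopCost d w pre =ᵐ[M.runMeasure x] fun _ => ((pre.length + 1 : ℕ) : ℝ≥0∞) + w := by
    filter_upwards [M.ae_zero_eq x] with ω hω
    exact stopCost_of_firstStop (t := 0) ⟨by rwa [prefixList_zero, hω], by simp⟩
  rw [stopValue, lintegral_congr_ae this]
  simp

/-- Together with `stopValue_of_stop` this is the one-step recursion through which an attempt on `M`
is compared with the chain on histories. -/
lemma stopValue_of_not_stop [Countable S] (M : Chain S O) {d : List S → Prop} {w : ℝ≥0∞}
    {pre : List S} {x : S} (hx : ¬ d (pre ++ [x])) :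
    M.stopValue d w pre x = ∑' t, M.trans x t * M.stopValue d w (pre ++ [x]) t := by
  rw [stopValue, lintegral_runMeasure_eq_tsum _ _ (measurable_stopCost _ _ _)]
  simp only [stopCost_consSeq hx]
  rfl

/-- The surcharge `w` is paid only on runs to which the rule applies at some time. -/
lemma stopValue_le [Countable S] (M : Chain S O) (d : List S → Prop) (w : ℝ≥0∞) (x : S) :
    M.stopValue d w [] x ≤
      M.stopValue d 0 [] x + M.runMeasure x {ω | ∃ t, d (prefixList ω t)} * w := by
  have hm : MeasurableSet {ω : ℕ → S | ∃ t, d (prefixList ω t)} := by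
    rw [show {ω : ℕ → S | ∃ t, d (prefixList ω t)} = ⋃ t, {ω | d (prefixList ω t)} by ext; simp]
    exact MeasurableSet.iUnion fun t => measurableSet_of_forall_le t fun ω ω' h hω => by
      simpa only [Set.mem_ofPred_eq, ← prefixList_congr h] using hω
  rw [mul_comm, ← lintegral_indicator_const hm, stopValue, stopValue,
    ← lintegral_add_left (measurable_stopCost _ _ _)]
  refine lintegral_mono fun ω => ?_
  by_cases h : ∃ t, FirstStop d [] ω t
  · obtain ⟨t, ht⟩ := h
    have hmem : ω ∈ {ω : ℕ → S | ∃ t, d (prefixList ω t)} := ⟨t, ht.1⟩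
    rw [stopCost_of_firstStop ht, stopCost_of_firstStop ht, Set.indicator_of_mem hmem, add_zero]
  · rw [stopCost_of_forall_not fun t ht => h ⟨t, ht⟩]
    exact zero_le

end Chain

/-! ### Histories -/

namespace History

variable {S : Type u}

/-- The states since the last restart, without the present one. -/
def current (h : History S Act) : List S :=
  (h.past.rtakeWhile fun p => decide (p.2 = Act.cont)).map Prod.fst

/-- The number of the present attempt. -/
def attempt (h : History S Act) : ℕ := h.past.countP (fun p => decide (p.2 = Act.restart)) + 1

lemma current_cont (past : List (S × Act)) (s t : S) :
    current ⟨past ++ [(s, Act.cont)], t⟩ = current ⟨past, s⟩ ++ [s] := by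
  simp [current, List.rtakeWhile_concat_pos]

lemma current_restart (past : List (S × Act)) (s t : S) :
    current ⟨past ++ [(s, Act.restart)], t⟩ = [] := by
  rw [current, List.rtakeWhile_concat_neg _ _ _ (by simp)]
  rfl

lemma attempt_cont (past : List (S × Act)) (s t : S) :
    attempt ⟨past ++ [(s, Act.cont)], t⟩ = attempt ⟨past, s⟩ := by
  simp [attempt]

lemma attempt_restart (past : List (S × Act)) (s t : S) :
    attempt ⟨past ++ [(s, Act.restart)], t⟩ = attempt ⟨past, s⟩ + 1 := by
  simp [attempt]

instance [Countable S] : Countable (History S Act) := by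
  have : Finite Act := Finite.of_surjective (fun b : Bool => if b then Act.restart else Act.cont)
    fun a => by cases a; exacts [⟨true, rfl⟩, ⟨false, rfl⟩]
  refine Function.Injective.countable (f := fun h : History S Act => (h.past, h.last)) ?_
  rintro ⟨p, l⟩ ⟨p', l'⟩ h
  simpa using h

end History

/-! ### Reduction of the restarted chain to single attempts -/

section Restart

variable {S : Type u} {O : Type v} (M : Chain S O) {σ : Strategy O Act} {d : ℕ → List S → Prop}

/-- The action of the strategy after the history `h`. -/
def actionAt (M : Chain S O) (σ : Strategy O Act) (h : History S Act) : Act :=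
  σ (h.past.map fun p => (M.obs p.1, p.2)) (M.obs h.last)

/-- In the `n`-th attempt the strategy restarts the chain exactly if the rule `d n` applies to the
path since the last restart. -/
def RestartsBy (M : Chain S O) (σ : Strategy O Act) (d : ℕ → List S → Prop) : Prop :=
  ∀ h : History S Act, actionAt M σ h = Act.restart ↔ d h.attempt (h.current ++ [h.last])

lemma tsum_map_mul {α : Type*} {β : Type*} (p : PMF α) (F : α → β) (V : β → ℝ≥0∞) :
    ∑' b, p.map F b * V b = ∑' a, p a * V (F a) := by
  classical
  simp only [PMF.map_apply, ← ENNReal.tsum_mul_right]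
  rw [ENNReal.tsum_comm]
  refine tsum_congr fun a => ?_
  rw [tsum_eq_single (F a)]
  · simp
  · intro b hb
    simp [hb]

lemma induced_trans (h : History S Act) :
    (M.restartMDP.induced σ).trans h =
      (M.restartMDP.trans h.last (actionAt M σ h)).map
        fun t => ⟨h.past ++ [(h.last, actionAt M σ h)], t⟩ := rfl

open Classical in
/-- The length of the present attempt if it ends after the history `h`, and `0` otherwise. -/
noncomputable def restartCost (d : ℕ → List S → Prop) (h : History S Act) : ℝ≥0∞ :=
  if d h.attempt (h.current ++ [h.last]) then ((h.current.length + 1 : ℕ) : ℝ≥0∞) else 0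

lemma past_of_edge {h h' : History S Act} (he : (M.restartMDP.induced σ).Edge h h') :
    h'.past = h.past ++ [(h.last, actionAt M σ h)] := by
  have h1 : h' ∈ ((M.restartMDP.induced σ).trans h).support := (PMF.mem_support_iff _ _).2 he.ne'
  rw [induced_trans, PMF.mem_support_map_iff] at h1
  obtain ⟨t, -, rfl⟩ := h1
  rfl

lemma current_of_edge_cont {h h' : History S Act} (he : (M.restartMDP.induced σ).Edge h h')
    (ha : actionAt M σ h = Act.cont) : h'.current = h.current ++ [h.last] := by
  have := past_of_edge M he
  obtain ⟨p, l⟩ := h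
  obtain ⟨p', l'⟩ := h'
  rw [ha] at this
  subst this
  exact History.current_cont _ _ _

lemma current_of_edge_restart {h h' : History S Act} (he : (M.restartMDP.induced σ).Edge h h')
    (ha : actionAt M σ h = Act.restart) : h'.current = [] := by
  have := past_of_edge M he
  obtain ⟨p, l⟩ := h
  obtain ⟨p', l'⟩ := h'
  rw [ha] at this
  subst this
  exact History.current_restart _ _ _

/-- Each step either lengthens the current path by one or closes the attempt, moving its length,
plus one for the restart step itself, into the sum. -/
lemma sum_restartCost_add_length (hσ : RestartsBy M σ d) {ρ : ℕ → History S Act}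
    (h0 : ρ 0 = (M.restartMDP.induced σ).init)
    (hρ : ∀ n, (M.restartMDP.induced σ).Edge (ρ n) (ρ (n + 1))) (n : ℕ) :
    ∑ i ∈ Finset.range n, restartCost d (ρ i) + ((ρ n).current.length : ℝ≥0∞) = n := by
  induction n with
  | zero =>
    rw [h0]
    simp [MDP.induced, History.current, List.rtakeWhile]
  | succ n ih =>
    rw [Finset.sum_range_succ]
    cases ha : actionAt M σ (ρ n) with
    | restart =>
      rw [current_of_edge_restart M (hρ n) ha, restartCost, if_pos ((hσ _).1 ha), List.length_nil,
        Nat.cast_zero, add_zero, Nat.cast_succ, Nat.cast_succ, ← ih, add_assoc]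
    | cont =>
      rw [current_of_edge_cont M (hρ n) ha, restartCost, if_neg (fun h => by
        rw [(hσ _).2 h] at ha; cases ha), List.length_append, List.length_singleton, add_zero,
        Nat.cast_succ, Nat.cast_succ, ← ih, add_assoc]

/-- Right after a restart the current path is empty, so the accumulated costs equal the elapsed
time. -/
lemma stepsToLastRestart_le (hσ : RestartsBy M σ d) {ρ : ℕ → History S Act}
    (h0 : ρ 0 = (M.restartMDP.induced σ).init)
    (hρ : ∀ n, (M.restartMDP.induced σ).Edge (ρ n) (ρ (n + 1))) :
    stepsToLastRestart ρ ≤ ∑' n, restartCost d (ρ n) := by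
  refine iSup₂_le fun n ⟨s, hs⟩ => ?_
  have ha : actionAt M σ (ρ n) = Act.restart := by
    rw [past_of_edge M (hρ n), List.getLast?_append] at hs
    simpa using congrArg (Option.map Prod.snd) hs
  have h := sum_restartCost_add_length M hσ h0 hρ (n + 1)
  rw [current_of_edge_restart M (hρ n) ha, List.length_nil, Nat.cast_zero, add_zero] at h
  rw [← h]
  exact ENNReal.sum_le_tsum _

variable [Countable S] [MeasurableSpace S] [DiscreteMeasurableSpace S]

/-- `W n` plays the role of an upper bound for all costs from the start of attempt `n` on. A restart
is charged `W (n + 1)` in advance, and `hW` makes this charge cover the next attempt. Induction on a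
finite horizon thus suffices, and the law of an attempt inside the history chain need not be
identified. -/
lemma lintegral_sum_restartCost_le (hσ : RestartsBy M σ d) {W : ℕ → ℝ≥0∞}
    (hW : ∀ n, 1 ≤ n → M.stopValue (d n) (W (n + 1)) [] M.init ≤ W n) (N : ℕ) (h : History S Act) :
    ∫⁻ ρ, ∑ i ∈ Finset.range N, restartCost d (ρ i) ∂(M.restartMDP.induced σ).runMeasure h ≤
      M.stopValue (d h.attempt) (W (h.attempt + 1)) h.current h.last := by
  induction N generalizing h with
  | zero => simp
  | succ N ih =>
    have hm : Measurable fun ρ : ℕ → History S Act =>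
        ∑ i ∈ Finset.range (N + 1), restartCost d (ρ i) :=
      Finset.measurable_sum _ fun i _ => (Measurable.of_discrete (f := restartCost d)).comp
        (measurable_pi_apply i)
    have hstep : ∫⁻ ρ, ∑ i ∈ Finset.range (N + 1), restartCost d (ρ i)
        ∂(M.restartMDP.induced σ).runMeasure h ≤ restartCost d h +
        ∑' h', (M.restartMDP.induced σ).trans h h' *
          M.stopValue (d h'.attempt) (W (h'.attempt + 1)) h'.current h'.last := by
      rw [Chain.lintegral_runMeasure_eq_tsum _ _ hm]
      calc _ ≤ ∑' h', (M.restartMDP.induced σ).trans h h' * (restartCost d h +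
          M.stopValue (d h'.attempt) (W (h'.attempt + 1)) h'.current h'.last) := by
            refine ENNReal.tsum_le_tsum fun h' => ?_
            gcongr
            simp only [Finset.sum_range_succ', consSeq_succ, consSeq_zero]
            rw [lintegral_add_right _ measurable_const, add_comm]
            simpa using add_le_add_right (ih h') _
        _ = _ := by
            simp only [mul_add, ENNReal.tsum_add, ENNReal.tsum_mul_right, PMF.tsum_coe, one_mul]
    refine hstep.trans ?_
    rw [induced_trans, tsum_map_mul]
    obtain ⟨past, x⟩ := h
    cases ha : actionAt M σ ⟨past, x⟩ with
    | restart =>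
      have hd := (hσ _).1 ha
      rw [restartCost, if_pos hd, Chain.stopValue_of_stop _ hd]
      gcongr
      simp only [History.attempt_restart, History.current_restart, Chain.restartMDP]
      rw [tsum_eq_single M.init]
      · simpa using hW _ (by omega)
      · intro t ht
        simp [PMF.pure_apply, ht]
    | cont =>
      have hd : ¬ d (History.attempt ⟨past, x⟩) (History.current ⟨past, x⟩ ++ [x]) := fun h => by
        rw [(hσ ⟨past, x⟩).2 h] at ha; cases ha
      rw [restartCost, if_neg hd, Chain.stopValue_of_not_stop _ hd, zero_add]
      simp only [History.attempt_cont, History.current_cont, Chain.restartMDP]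
      rfl

lemma expectedSteps_le_of_superharmonic (hσ : RestartsBy M σ d) {W : ℕ → ℝ≥0∞}
    (hW : ∀ n, 1 ≤ n → M.stopValue (d n) (W (n + 1)) [] M.init ≤ W n) :
    M.expectedSteps σ ≤ W 1 := by
  calc M.expectedSteps σ
      ≤ ∫⁻ ρ, ∑' n, restartCost d (ρ n)
          ∂(M.restartMDP.induced σ).runMeasure (M.restartMDP.induced σ).init := by
        refine lintegral_mono_ae ?_
        filter_upwards [Chain.ae_zero_eq (M.restartMDP.induced σ) (M.restartMDP.induced σ).init,
          Chain.ae_edge (M.restartMDP.induced σ) (M.restartMDP.induced σ).init] with ρ h0 hρ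
        exact stepsToLastRestart_le M hσ h0 hρ
    _ ≤ W 1 := by
        have hm (i : ℕ) : Measurable fun ρ : ℕ → History S Act => restartCost d (ρ i) :=
          (Measurable.of_discrete (f := restartCost d)).comp (measurable_pi_apply i)
        rw [lintegral_tsum fun i => (hm i).aemeasurable, ENNReal.tsum_eq_iSup_nat]
        refine iSup_le fun N => ?_
        rw [← lintegral_finsetSum _ fun i _ => hm i]
        exact (lintegral_sum_restartCost_le M hσ hW N _).trans (hW 1 le_rfl)

/-- A bound on the expected number of steps in terms of the expected lengths `e n` of the attempts
and of the probabilities `q n` that an attempt ends. -/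
lemma expectedSteps_le_tsum (hσ : RestartsBy M σ d) {e q : ℕ → ℝ≥0∞}
    (he : ∀ n, 1 ≤ n → M.stopValue (d n) 0 [] M.init ≤ e n)
    (hq : ∀ n, 1 ≤ n → M.runMeasure M.init {ω | ∃ t, d n (prefixList ω t)} ≤ q n) :
    M.expectedSteps σ ≤ ∑' m, (∏ i ∈ Finset.range m, q (i + 1)) * e (m + 1) := by
  -- This `W` is the solution of `W n = e n + q n * W (n + 1)` obtained by unfolding the recursion.
  have key := expectedSteps_le_of_superharmonic M hσ
    (W := fun n => ∑' m, (∏ i ∈ Finset.range m, q (n + i)) * e (n + m)) ?_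
  · simpa only [add_comm 1] using key
  intro n hn
  refine (M.stopValue_le _ _ _).trans ?_
  rw [tsum_eq_zero_add' (f := fun m => (∏ i ∈ Finset.range m, q (n + i)) * e (n + m))
    ENNReal.summable, Finset.range_zero, Finset.prod_empty, one_mul, add_zero,
    ← ENNReal.tsum_mul_left]
  refine add_le_add (he n hn) (ENNReal.tsum_le_tsum fun m => ?_)
  rw [Finset.prod_range_succ', ← mul_assoc, mul_comm (M.runMeasure M.init _), add_zero]
  simp only [add_assoc, add_comm 1]
  gcongr
  exact hq n hn

end Restart

/-! ### Bottom components and existence of progress paths -/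

namespace Chain

section graph

variable {S : Type u} {O : Type v} {M : Chain S O}

lemma exists_edge (M : Chain S O) (s : S) : ∃ t, M.Edge s t := by
  obtain ⟨t, ht⟩ := (M.trans s).support_nonempty
  exact ⟨t, pos_iff_ne_zero.2 ((PMF.mem_support_iff _ _).1 ht)⟩

lemma IsBSCC.mem_of_reach {B : Set S} (hB : M.IsBSCC B) {s t : S} (hs : s ∈ B)
    (h : M.Reach s t) : t ∈ B := by
  induction h with
  | refl => exact hs
  | tail _ he ih => exact hB.2.2 _ ih _ he

lemma IsBSCC.eq {B B' : Set S} (hB : M.IsBSCC B) (hB' : M.IsBSCC B') {s : S} (hs : s ∈ B)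
    (hs' : s ∈ B') : B = B' :=
  Set.Subset.antisymm (fun t ht => hB'.mem_of_reach hs' (hB.2.1 s hs t ht))
    fun t ht => hB.mem_of_reach hs (hB'.2.1 s hs' t ht)

/-- Among the states reachable from `s`, one with the fewest reachable states can be reached back
from each of its descendants. -/
lemma exists_isBSCC_reach [Finite S] (M : Chain S O) (s : S) :
    ∃ B, M.IsBSCC B ∧ ∃ t ∈ B, M.Reach s t := by
  obtain ⟨t, hst, hmin⟩ := Set.exists_min_image {t | M.Reach s t}
    (fun t => {u | M.Reach t u}.ncard) (Set.toFinite _) ⟨s, Relation.ReflTransGen.refl⟩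
  have hback (u : S) (hu : M.Reach t u) : M.Reach u t := by
    have hsub : {v | M.Reach u v} ⊆ {v | M.Reach t v} := fun v hv => hu.trans hv
    have := Set.eq_of_subset_of_ncard_le hsub (hmin u (hst.trans hu)) (Set.toFinite _)
    have ht : t ∈ {v | M.Reach t v} := Relation.ReflTransGen.refl
    rwa [← this] at ht
  exact ⟨{u | M.Reach t u}, ⟨⟨t, Relation.ReflTransGen.refl⟩,
    fun u hu v hv => (hback u hu).trans hv, fun u hu v hv => Relation.ReflTransGen.tail hu hv⟩,
    t, Relation.ReflTransGen.refl, hst⟩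

lemma reach_of_edge {ω : ℕ → S} (hω : ∀ n, M.Edge (ω n) (ω (n + 1))) {m n : ℕ} (h : m ≤ n) :
    M.Reach (ω m) (ω n) := by
  induction n, h using Nat.le_induction with
  | base => exact Relation.ReflTransGen.refl
  | succ n _ ih => exact ih.tail (hω n)

/-- Following `ρ` for `m` steps and `ρ'` afterwards. -/
def concat (ρ ρ' : ℕ → S) (m i : ℕ) : S := if i ≤ m then ρ i else ρ' (i - m)

lemma concat_of_le {ρ ρ' : ℕ → S} {m i : ℕ} (h : i ≤ m) : concat ρ ρ' m i = ρ i := if_pos h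

lemma concat_add {ρ ρ' : ℕ → S} {m : ℕ} (h : ρ' 0 = ρ m) (i : ℕ) :
    concat ρ ρ' m (m + i) = ρ' i := by
  rcases Nat.eq_zero_or_pos i with rfl | hi
  · rw [add_zero, concat_of_le le_rfl, h]
  · rw [concat, if_neg (by omega), Nat.add_sub_cancel_left]

lemma IsPath.concat {ρ ρ' : ℕ → S} {m m' : ℕ} (h : M.IsPath ρ m) (h' : M.IsPath ρ' m')
    (he : ρ' 0 = ρ m) : M.IsPath (concat ρ ρ' m) (m + m') := by
  intro i hi
  rcases lt_or_ge i m with him | him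
  · rw [concat_of_le him.le, concat_of_le him]
    exact h i him
  · obtain ⟨j, rfl⟩ := Nat.exists_eq_add_of_le him
    rw [add_assoc, concat_add he, concat_add he]
    exact h' j (by omega)

lemma exists_isPath_of_reach {s t : S} (h : M.Reach s t) :
    ∃ (ρ : ℕ → S) (m : ℕ), ρ 0 = s ∧ ρ m = t ∧ M.IsPath ρ m := by
  induction h with
  | refl => exact ⟨fun _ => s, 0, rfl, rfl, fun i hi => absurd hi (Nat.not_lt_zero i)⟩
  | @tail u v _ he ih =>
    obtain ⟨ρ, m, h0, hm, hp⟩ := ih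
    have hp' : M.IsPath (fun i => if i = 0 then u else v) 1 := by
      intro i hi
      obtain rfl : i = 0 := by omega
      simpa using he
    refine ⟨concat ρ _ m, m + 1, by rw [concat_of_le (Nat.zero_le m), h0], ?_,
      hp.concat hp' (by simp [hm])⟩
    rw [concat_add (by simp [hm])]
    simp

/-- From every state of a bottom component there is a path of positive length that visits any given
states of the component. -/
lemma IsBSCC.exists_isPath_visiting {B : Set S} (hB : M.IsBSCC B) {s : S} (hs : s ∈ B)
    (F : Finset S) : (∀ u ∈ F, u ∈ B) → ∃ (ρ : ℕ → S) (m : ℕ), ρ 0 = s ∧ 1 ≤ m ∧ M.IsPath ρ m ∧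
      ρ m ∈ B ∧ ∀ u ∈ F, ∃ j, 1 ≤ j ∧ j ≤ m ∧ ρ j = u := by
  classical
  induction F using Finset.induction_on with
  | empty =>
    intro _
    obtain ⟨t, ht⟩ := M.exists_edge s
    refine ⟨fun i => if i = 0 then s else t, 1, rfl, le_rfl, ?_, ?_, by simp⟩
    · intro i hi
      obtain rfl : i = 0 := by omega
      simpa using ht
    · simpa using hB.2.2 s hs t ht
  | insert a F ha ih =>
    intro hF
    obtain ⟨ρ, m, h0, hm, hp, hmB, hv⟩ := ih fun u hu => hF u (Finset.mem_insert_of_mem hu)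
    obtain ⟨ρ', m', h0', hm', hp'⟩ :=
      exists_isPath_of_reach (hB.2.1 _ hmB a (hF a (Finset.mem_insert_self _ _)))
    refine ⟨concat ρ ρ' m, m + m', by rw [concat_of_le (Nat.zero_le m), h0], by omega,
      hp.concat hp' h0', ?_, ?_⟩
    · rw [concat_add h0', hm']
      exact hF a (Finset.mem_insert_self _ _)
    · intro u hu
      rcases Finset.mem_insert.1 hu with rfl | hu
      · exact ⟨m + m', by omega, le_rfl, by rw [concat_add h0', hm']⟩
      · obtain ⟨j, hj1, hjm, hj⟩ := hv u hu
        exact ⟨j, hj1, by omega, by rw [concat_of_le hjm, hj]⟩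

end graph

variable {S : Type u} {k : ℕ} {M : Chain S (Set (Marker k))}

lemma goodStates_subset_goodReach : M.goodStates ⊆ M.goodReach :=
  fun s hs => ⟨s, hs, Relation.ReflTransGen.refl⟩

lemma badStates_subset_badReach : M.badStates ⊆ M.badReach :=
  fun s hs => ⟨s, hs, Relation.ReflTransGen.refl⟩

lemma mem_goodStates_of_reach {s t : S} (hs : s ∈ M.goodStates) (h : M.Reach s t) :
    t ∈ M.goodStates :=
  let ⟨B, hB, hsB, hi⟩ := hs
  ⟨B, hB, hB.mem_of_reach hsB h, hi⟩

lemma mem_badStates_of_reach {s t : S} (hs : s ∈ M.badStates) (h : M.Reach s t) :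
    t ∈ M.badStates :=
  let ⟨B, hB, hsB, hi⟩ := hs
  ⟨B, hB, hB.mem_of_reach hsB h, hi⟩

lemma mem_goodReach_of_reach {s t : S} (ht : t ∈ M.goodReach) (h : M.Reach s t) :
    s ∈ M.goodReach :=
  let ⟨u, hu, htu⟩ := ht
  ⟨u, hu, h.trans htu⟩

lemma mem_badReach_of_reach {s t : S} (ht : t ∈ M.badReach) (h : M.Reach s t) :
    s ∈ M.badReach :=
  let ⟨u, hu, htu⟩ := ht
  ⟨u, hu, h.trans htu⟩

lemma mem_goodStates_or_badStates {B : Set S} (hB : M.IsBSCC B) {s : S} (hs : s ∈ B) :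
    s ∈ M.goodStates ∨ s ∈ M.badStates := by
  by_cases h : ∃ i, M.IsGoodFor i B
  · exact Or.inl ⟨B, hB, hs, h⟩
  · exact Or.inr ⟨B, hB, hs, h⟩

lemma mem_goodReach_or_badReach [Finite S] (s : S) : s ∈ M.goodReach ∨ s ∈ M.badReach := by
  obtain ⟨B, hB, t, ht, hst⟩ := M.exists_isBSCC_reach s
  exact (mem_goodStates_or_badStates hB ht).imp (fun h => ⟨t, h, hst⟩) fun h => ⟨t, h, hst⟩

lemma exists_goodProgress {s : S} (hs : s ∈ M.goodStates) :
    ∃ m, ∃ ρ : ℕ → S, ρ 0 = s ∧ M.IsPath ρ m ∧ M.GoodProgress ρ 0 m := by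
  obtain ⟨B, hB, hsB, i, ⟨t, htB, hti⟩, hi⟩ := hs
  obtain ⟨ρ, m, h0, -, hp, -, hv⟩ := hB.exists_isPath_visiting hsB {t} (by simpa using htB)
  obtain ⟨j, hj1, hjm, hj⟩ := hv t (by simp)
  refine ⟨j, ρ, h0, fun l hl => hp l (by omega), hj1, Or.inr ⟨B, i, hB, h0 ▸ hsB,
    ⟨⟨t, htB, hti⟩, hi⟩, hj ▸ hti⟩⟩

/-- A path through all states of the bad component works: if `eᵢ` occurs there then so does `fᵢ`,
since otherwise the component would be `i`-good. -/
lemma exists_badProgress [Fintype S] {s : S} (hs : s ∈ M.badStates) :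
    ∃ m, ∃ ρ : ℕ → S, ρ 0 = s ∧ M.IsPath ρ m ∧ M.BadProgress ρ 0 m := by
  classical
  obtain ⟨B, hB, hsB, hbad⟩ := hs
  obtain ⟨ρ, m, h0, hm, hp, -, hv⟩ :=
    hB.exists_isPath_visiting hsB (Finset.univ.filter (· ∈ B)) (by simp)
  refine ⟨m, ρ, h0, hp, hm, Or.inr ⟨B, hB, hbad, h0 ▸ hsB, fun i hi => ?_⟩⟩
  by_contra! hno
  refine hbad ⟨i, hi, fun t ht hf => ?_⟩
  obtain ⟨j, -, hjm, hj⟩ := hv t (by simpa using ht)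
  exact hno j (Nat.zero_le j) hjm (hj ▸ hf)

lemma one_le_radius [Fintype S] {prog : (ℕ → S) → ℕ → ℕ → Prop} {T : Set S} {s : S} (hs : s ∈ T)
    (hlt : ∀ ρ a b, prog ρ a b → a < b)
    (h : ∃ m, ∃ ρ : ℕ → S, ρ 0 = s ∧ M.IsPath ρ m ∧ prog ρ 0 m) : 1 ≤ M.radius prog T := by
  classical
  have h1 : 1 ≤ M.shortest prog s := by
    -- On the empty set `sInf` would be `0`; the existence of a progress path excludes this default.
    obtain ⟨ρ, -, -, hρ⟩ := Nat.sInf_mem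
      (s := {m | ∃ ρ : ℕ → S, ρ 0 = s ∧ M.IsPath ρ m ∧ prog ρ 0 m}) h
    exact hlt _ _ _ hρ
  exact h1.trans (Finset.le_sup (f := M.shortest prog) (by simpa using hs))

lemma one_le_progressRadius [Fintype S] (M : Chain S (Set (Marker k))) : 1 ≤ M.progressRadius := by
  obtain ⟨B, hB, t, ht, -⟩ := M.exists_isBSCC_reach M.init
  rcases mem_goodStates_or_badStates hB ht with h | h
  · exact (one_le_radius h (fun _ _ _ h => h.1) (exists_goodProgress h)).trans
      ((le_max_right _ _).trans (le_max_left _ _))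
  · exact (one_le_radius h (fun _ _ _ h => h.1) (exists_badProgress h)).trans
      ((le_max_right _ _).trans (le_max_right _ _))

/-! ### Runs without progress -/

/-- Between the times `a` and `b` the sequence `ω` stays in `T` without making progress. -/
def Stuck {S : Type u} (T : Set S) (prog : (ℕ → S) → ℕ → ℕ → Prop) (ω : ℕ → S) (a b : ℕ) : Prop :=
  (∀ t, a ≤ t → t ≤ b → ω t ∈ T) ∧ ∀ a' b', a ≤ a' → b' ≤ b → ¬ prog ω a' b'

lemma Stuck.mono {T : Set S} {prog : (ℕ → S) → ℕ → ℕ → Prop} {ω : ℕ → S} {a b a' b' : ℕ}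
    (h : Stuck T prog ω a b) (ha : a ≤ a') (hb : b' ≤ b) : Stuck T prog ω a' b' :=
  ⟨fun t h₁ h₂ => h.1 t (ha.trans h₁) (h₂.trans hb),
    fun c d h₁ h₂ => h.2 c d (ha.trans h₁) (h₂.trans hb)⟩

/-- The observations between the times `a` and `b` satisfy the criterion for the second half of a
path. -/
def GoodWindow (M : Chain S (Set (Marker k))) (ω : ℕ → S) (a b : ℕ) : Prop :=
  ∃ i : Fin k, (∃ t, a ≤ t ∧ t ≤ b ∧ Marker.e i ∈ M.obs (ω t)) ∧
    ∀ t, a ≤ t → t ≤ b → Marker.f i ∉ M.obs (ω t)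

variable {ω : ℕ → S}

lemma mem_goodStates_of_isGoodFor {B : Set S} {i : Fin k} {s : S} (hB : M.IsBSCC B) (hs : s ∈ B)
    (hi : M.IsGoodFor i B) : s ∈ M.goodStates := ⟨B, hB, hs, i, hi⟩

/-- Good components cannot be left, so they are avoided up to time `m`, whereas a good progress path
of either kind has an endpoint in one. -/
lemma stuck_good_of_mem_diff (hω : ∀ n, M.Edge (ω n) (ω (n + 1))) {m : ℕ}
    (hm : ω m ∈ M.goodReach \ M.goodStates) : Stuck M.goodReach M.GoodProgress ω 0 m := by
  have hnot (t : ℕ) (ht : t ≤ m) : ω t ∉ M.goodStates := fun h =>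
    hm.2 (mem_goodStates_of_reach h (reach_of_edge hω ht))
  refine ⟨fun t _ ht => mem_goodReach_of_reach hm.1 (reach_of_edge hω ht), ?_⟩
  rintro a b - hb ⟨hab, ⟨-, h⟩ | ⟨B, i, hB, ha, hi, -⟩⟩
  · exact hnot b hb h
  · exact hnot a (by omega) (mem_goodStates_of_isGoodFor hB ha hi)

lemma stuck_bad_of_mem_diff (hω : ∀ n, M.Edge (ω n) (ω (n + 1))) {m : ℕ}
    (hm : ω m ∈ M.badReach \ M.badStates) : Stuck M.badReach M.BadProgress ω 0 m := by
  have hnot (t : ℕ) (ht : t ≤ m) : ω t ∉ M.badStates := fun h =>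
    hm.2 (mem_badStates_of_reach h (reach_of_edge hω ht))
  refine ⟨fun t _ ht => mem_badReach_of_reach hm.1 (reach_of_edge hω ht), ?_⟩
  rintro a b - hb ⟨hab, ⟨-, h⟩ | ⟨B, hB, hi, ha, -⟩⟩
  · exact hnot b hb h
  · exact hnot a (by omega) ⟨B, hB, ha, hi⟩

/-- A progress path inside the window would end at some `eᵢ` for which the component is free of
`fᵢ`, and this `i` would make the window good. -/
lemma stuck_good_of_not_goodWindow (hω : ∀ n, M.Edge (ω n) (ω (n + 1))) {a b : ℕ}
    (ha : ω a ∈ M.goodStates) (hab : ¬ M.GoodWindow ω a b) :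
    Stuck M.goodReach M.GoodProgress ω a b := by
  refine ⟨fun t h _ => goodStates_subset_goodReach
    (mem_goodStates_of_reach ha (reach_of_edge hω h)), ?_⟩
  rintro a' b' ha' hb' ⟨hlt, ⟨h, -⟩ | ⟨B, i, hB, haB, hi, he⟩⟩
  · exact h.2 (mem_goodStates_of_reach ha (reach_of_edge hω ha'))
  · refine hab ⟨i, ⟨b', by omega, hb', he⟩, fun t hat _ => hi.2 _ ?_⟩
    obtain ⟨B', hB', haB', -⟩ := ha
    rw [hB.eq hB' haB (hB'.mem_of_reach haB' (reach_of_edge hω ha'))]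
    exact hB'.mem_of_reach haB' (reach_of_edge hω hat)

/-- If `i` witnesses that the window is good, then `eᵢ` occurs in the component, so a bad progress
path inside the window would have to visit `fᵢ`. -/
lemma stuck_bad_of_goodWindow (hω : ∀ n, M.Edge (ω n) (ω (n + 1))) {a b : ℕ}
    (ha : ω a ∈ M.badStates) (hab : M.GoodWindow ω a b) :
    Stuck M.badReach M.BadProgress ω a b := by
  refine ⟨fun t h _ => badStates_subset_badReach
    (mem_badStates_of_reach ha (reach_of_edge hω h)), ?_⟩
  rintro a' b' ha' hb' ⟨hlt, ⟨h, -⟩ | ⟨B, hB, -, haB, hf⟩⟩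
  · exact h.2 (mem_badStates_of_reach ha (reach_of_edge hω ha'))
  · obtain ⟨i, ⟨t, hat, -, he⟩, hno⟩ := hab
    obtain ⟨B', hB', haB', -⟩ := ha
    obtain rfl := hB.eq hB' haB (hB'.mem_of_reach haB' (reach_of_edge hω ha'))
    obtain ⟨j, h1, h2, h3⟩ := hf i ⟨ω t, hB.mem_of_reach haB' (reach_of_edge hω hat), he⟩
    exact hno j (by omega) (by omega) h3

/-- A good run that makes bad progress again and again while this is possible remains among the
states from which a good component can be reached. -/
lemma mem_goodReach_of_rabin [Finite S] (hω : ∀ n, M.Edge (ω n) (ω (n + 1)))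
    (hprog : ∀ a, ∃ b, ¬ Stuck M.badReach M.BadProgress ω a b)
    (hgood : (fun n => M.obs (ω n)) ∈ rabinLanguage k) (t : ℕ) : ω t ∈ M.goodReach := by
  by_contra hnot
  have hbad (n : ℕ) (hn : t ≤ n) : ω n ∈ M.badReach :=
    (mem_goodReach_or_badReach (ω n)).resolve_left fun h =>
      hnot (mem_goodReach_of_reach h (reach_of_edge hω hn))
  have hex (a : ℕ) (ha : t ≤ a) : ∃ a' b', a ≤ a' ∧ M.BadProgress ω a' b' := by
    by_contra! hno
    obtain ⟨b, hb⟩ := hprog a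
    exact hb ⟨fun n hn _ => hbad n (ha.trans hn), fun a' b' ha' _ => hno a' b' ha'⟩
  obtain ⟨n, hn⟩ : ∃ n, ω n ∈ M.badStates := by
    obtain ⟨a, b, -, -, ⟨-, h⟩ | ⟨B, hB, hi, ha, -⟩⟩ := hex t le_rfl
    · exact ⟨b, h⟩
    · exact ⟨a, B, hB, ha, hi⟩
  obtain ⟨B, hB, hnB, -⟩ := id hn
  obtain ⟨i, he, hf⟩ := hgood
  obtain ⟨l, hl, hnl⟩ := he.exists_gt n
  obtain ⟨N, hN⟩ := hf.bddAbove
  -- `N` bounds all times at which `fᵢ` is seen, but `eᵢ` occurs in the component, so a progress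
  -- path that starts after `N` visits `fᵢ` once more.
  obtain ⟨a, b, ha, -, ⟨h, -⟩ | ⟨B', hB', -, haB', hv⟩⟩ := hex (max t (max n (N + 1))) (by omega)
  · exact h.2 (mem_badStates_of_reach hn (reach_of_edge hω (by omega)))
  · obtain rfl := hB'.eq hB haB' (hB.mem_of_reach hnB (reach_of_edge hω (by omega)))
    obtain ⟨j, hj, -, hfj⟩ := hv i ⟨ω l, hB'.mem_of_reach hnB (reach_of_edge hω hnl.le), hl⟩
    have : j ≤ N := hN hfj
    omega

/-- If the window that starts at `m` is good and the one that starts at `n > m` is not, then there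
is a long period without progress. -/
lemma stuck_of_goodWindow_of_not_goodWindow [Finite S] (hω : ∀ n, M.Edge (ω n) (ω (n + 1)))
    {m n m' n' : ℕ} (hmn : m ≤ n) (hm : M.GoodWindow ω m m') (hn : ¬ M.GoodWindow ω n n') :
    Stuck M.goodReach M.GoodProgress ω 0 m ∨ Stuck M.badReach M.BadProgress ω 0 m ∨
      Stuck M.badReach M.BadProgress ω m m' ∨ Stuck M.goodReach M.GoodProgress ω n n' := by
  by_cases hg : ω m ∈ M.goodStates
  · exact Or.inr <| Or.inr <| Or.inr <|
      stuck_good_of_not_goodWindow hω (mem_goodStates_of_reach hg (reach_of_edge hω hmn)) hn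
  by_cases hb : ω m ∈ M.badStates
  · exact Or.inr <| Or.inr <| Or.inl <| stuck_bad_of_goodWindow hω hb hm
  rcases mem_goodReach_or_badReach (M := M) (ω m) with h | h
  · exact Or.inl (stuck_good_of_mem_diff hω ⟨h, hg⟩)
  · exact Or.inr (Or.inl (stuck_bad_of_mem_diff hω ⟨h, hb⟩))

end Chain

/-! ### Probability of being stuck and of reaching a good component -/

namespace Chain

variable {S : Type u} {k : ℕ} {M : Chain S (Set (Marker k))}

/-- Whether a stretch of a sequence makes progress depends on this stretch only. -/
structure IsLocal (prog : (ℕ → S) → ℕ → ℕ → Prop) : Prop where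
  congr : ∀ {ω ω' : ℕ → S} {a b : ℕ}, (∀ i ≤ b, ω i = ω' i) → prog ω a b → prog ω' a b
  of_shift : ∀ {ω : ℕ → S} {m a b : ℕ}, prog (fun i => ω (m + i)) a b → prog ω (m + a) (m + b)

lemma isLocal_goodProgress (M : Chain S (Set (Marker k))) : IsLocal M.GoodProgress where
  congr {ω ω' a b} h hp := by
    have ha := h a hp.1.le
    have hb := h b le_rfl
    simpa only [GoodProgress, ha, hb] using hp
  of_shift hp := ⟨Nat.add_lt_add_left hp.1 _, hp.2⟩

lemma isLocal_badProgress (M : Chain S (Set (Marker k))) : IsLocal M.BadProgress where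
  congr {ω ω' a b} h hp := by
    have ha := h a hp.1.le
    have hb := h b le_rfl
    refine ⟨hp.1, ?_⟩
    rw [← ha, ← hb]
    refine hp.2.imp id ?_
    rintro ⟨B, hB, hbad, haB, hv⟩
    refine ⟨B, hB, hbad, haB, fun i hi => ?_⟩
    obtain ⟨j, h1, h2, h3⟩ := hv i hi
    exact ⟨j, h1, h2, h j h2 ▸ h3⟩
  of_shift {ω m a b} hp := by
    refine ⟨Nat.add_lt_add_left hp.1 _, hp.2.imp id ?_⟩
    rintro ⟨B, hB, hbad, haB, hv⟩
    refine ⟨B, hB, hbad, haB, fun i hi => ?_⟩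
    obtain ⟨j, h1, h2, h3⟩ := hv i hi
    exact ⟨m + j, by omega, by omega, h3⟩

lemma Stuck.congr {T : Set S} {prog : (ℕ → S) → ℕ → ℕ → Prop} (hp : IsLocal prog) {ω ω' : ℕ → S}
    {a b : ℕ} (h : ∀ i ≤ b, ω i = ω' i) (hω : Stuck T prog ω a b) : Stuck T prog ω' a b :=
  ⟨fun t h₁ h₂ => h t h₂ ▸ hω.1 t h₁ h₂, fun c d h₁ h₂ hcd => hω.2 c d h₁ h₂
    (hp.congr (fun i hi => (h i (hi.trans h₂)).symm) hcd)⟩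

lemma Stuck.shift {T : Set S} {prog : (ℕ → S) → ℕ → ℕ → Prop} (hp : IsLocal prog) {ω : ℕ → S}
    {m a b : ℕ} (hω : Stuck T prog ω (m + a) (m + b)) : Stuck T prog (fun i => ω (m + i)) a b :=
  ⟨fun t _ _ => hω.1 (m + t) (by omega) (by omega),
    fun c d _ _ hcd => hω.2 (m + c) (m + d) (by omega) (by omega) (hp.of_shift hcd)⟩

section prob

variable [MeasurableSpace S] [DiscreteMeasurableSpace S]

lemma minProb_le {prog : (ℕ → S) → ℕ → ℕ → Prop} {T : Set S} {r r' : ℕ} (hr : r ≤ r') {s : S}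
    (hs : s ∈ T) :
    M.minProb prog T r ≤ M.runMeasure s {ω | ∃ a b, b ≤ r' ∧ prog ω a b} :=
  (iInf₂_le s hs).trans (measure_mono fun _ ⟨a, b, hb, h⟩ => ⟨a, b, hb.trans hr, h⟩)

lemma measurableSet_coord (T : Set S) (t : ℕ) : MeasurableSet {ω : ℕ → S | ω t ∈ T} :=
  measurable_pi_apply t MeasurableSet.of_discrete

variable [Countable S]

lemma measurableSet_stuck {T : Set S} {prog : (ℕ → S) → ℕ → ℕ → Prop} (hp : IsLocal prog)
    (a b : ℕ) : MeasurableSet {ω | Stuck T prog ω a b} :=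
  measurableSet_of_forall_le b fun _ _ h hω => Stuck.congr hp h hω

lemma measurableSet_exists_prog {prog : (ℕ → S) → ℕ → ℕ → Prop} (hp : IsLocal prog) (r : ℕ) :
    MeasurableSet {ω | ∃ a b, b ≤ r ∧ prog ω a b} :=
  measurableSet_of_forall_le r fun _ _ h ⟨a, b, hb, hab⟩ =>
    ⟨a, b, hb, hp.congr (fun i hi => h i (hi.trans hb)) hab⟩

/-- A run stuck for `R * j` steps is stuck on `j` consecutive blocks of `R` steps; the Markov
property is applied at the end of the first one. -/
lemma runMeasure_stuck_le_pow {T : Set S} {prog : (ℕ → S) → ℕ → ℕ → Prop} (hp : IsLocal prog)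
    {R : ℕ} {x : ℝ≥0∞} (hx : ∀ s, M.runMeasure s {ω | Stuck T prog ω 0 R} ≤ x) (j : ℕ) (s : S) :
    M.runMeasure s {ω | Stuck T prog ω 0 (R * j)} ≤ x ^ j := by
  induction j generalizing s with
  | zero => simpa using prob_le_one
  | succ j ih =>
    calc M.runMeasure s {ω | Stuck T prog ω 0 (R * (j + 1))}
        ≤ M.runMeasure s ({ω | Stuck T prog ω 0 R} ∩
            {ω | (fun i => ω (R + i)) ∈ {ω | Stuck T prog ω 0 (R * j)}}) := by
          refine measure_mono fun ω hω => ⟨Stuck.mono hω le_rfl (by nlinarith), ?_⟩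
          refine Stuck.shift hp (Stuck.mono hω (Nat.zero_le _) (le_of_eq ?_))
          ring
      _ ≤ x ^ j * M.runMeasure s {ω | Stuck T prog ω 0 R} :=
          M.runMeasure_inter_shift_le R s (D := Set.univ) (fun _ _ h hω => Stuck.congr hp h hω)
            (fun _ _ => trivial) (measurableSet_stuck hp _ _) fun t _ => ih t
      _ ≤ x ^ (j + 1) := by
          rw [pow_succ]
          gcongr
          exact hx s

/-- The event `A` is decided by time `m`, so its probability survives as a factor. This is what
later keeps the union bound over the checks relative to `A`. -/
lemma runMeasure_inter_stuck_le {T : Set S} {prog : (ℕ → S) → ℕ → ℕ → Prop} (hp : IsLocal prog)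
    {R : ℕ} {x : ℝ≥0∞} (hx : ∀ s, M.runMeasure s {ω | Stuck T prog ω 0 R} ≤ x) (s : S)
    {A : Set (ℕ → S)} {m : ℕ} (hA : ∀ ω ω' : ℕ → S, (∀ i ≤ m, ω i = ω' i) → ω ∈ A → ω' ∈ A)
    {a b h : ℕ} (hma : m ≤ a) (hab : a + h ≤ b) :
    M.runMeasure s (A ∩ {ω | Stuck T prog ω a b}) ≤ x ^ (h / R) * M.runMeasure s A := by
  have key (t : S) : M.runMeasure t {ω | Stuck T prog ω 0 h} ≤ x ^ (h / R) :=
    (measure_mono fun ω hω => Stuck.mono hω le_rfl (Nat.mul_div_le h R)).trans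
      (runMeasure_stuck_le_pow hp hx _ t)
  refine (measure_mono ?_).trans (M.runMeasure_inter_shift_le a s (D := Set.univ)
    (fun ω ω' h' => hA ω ω' fun i hi => h' i (hi.trans hma)) (fun _ _ => trivial)
    (measurableSet_stuck hp 0 h) fun t _ => key t)
  exact Set.inter_subset_inter_right _ fun ω hω => Stuck.shift hp (Stuck.mono hω le_rfl hab)

lemma runMeasure_stuck_le {T : Set S} {prog : (ℕ → S) → ℕ → ℕ → Prop} (hp : IsLocal prog)
    {R : ℕ} {x : ℝ≥0∞} (hx : ∀ s, M.runMeasure s {ω | Stuck T prog ω 0 R} ≤ x) (s : S)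
    {a b h : ℕ} (hab : a + h ≤ b) :
    M.runMeasure s {ω | Stuck T prog ω a b} ≤ x ^ (h / R) := by
  have := runMeasure_inter_stuck_le hp hx s (A := Set.univ) (m := 0) (fun _ _ _ _ => trivial)
    (Nat.zero_le a) hab
  simpa using this

lemma runMeasure_no_prog_le {prog : (ℕ → S) → ℕ → ℕ → Prop} (hp : IsLocal prog) {r : ℕ}
    {p : ℝ≥0∞} {s : S} (h : p ≤ M.runMeasure s {ω | ∃ a b, b ≤ r ∧ prog ω a b}) :
    M.runMeasure s {ω | ∃ a b, b ≤ r ∧ prog ω a b}ᶜ ≤ 1 - p := by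
  rw [prob_compl_eq_one_sub (measurableSet_exists_prog hp r)]
  exact tsub_le_tsub_left h 1

lemma runMeasure_stuck_le_of_forall {T : Set S} {prog : (ℕ → S) → ℕ → ℕ → Prop}
    (hp : IsLocal prog) {r : ℕ} {p : ℝ≥0∞}
    (h : ∀ s ∈ T, p ≤ M.runMeasure s {ω | ∃ a b, b ≤ r ∧ prog ω a b}) (s : S) :
    M.runMeasure s {ω | Stuck T prog ω 0 r} ≤ 1 - p := by
  by_cases hs : s ∈ T
  · refine (measure_mono ?_).trans (runMeasure_no_prog_le hp (h s hs))
    rintro ω hω ⟨a, b, hb, hab⟩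
    exact hω.2 a b (Nat.zero_le a) hb hab
  · have h0 := M.ae_zero_eq s
    rw [ae_iff] at h0
    refine (measure_mono_null (fun ω hω => ?_) h0).trans_le zero_le
    exact fun h1 : ω 0 = s => hs (h1 ▸ hω.1 0 le_rfl (Nat.zero_le r))

end prob

section finite

variable [Fintype S] [MeasurableSpace S] [DiscreteMeasurableSpace S]

lemma progressProb_le_good (M : Chain S (Set (Marker k))) {s : S} (hs : s ∈ M.goodReach) :
    M.progressProb ≤
      M.runMeasure s {ω | ∃ a b, b ≤ M.progressRadius ∧ M.GoodProgress ω a b} := by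
  by_cases h : s ∈ M.goodStates
  · exact ((min_le_left _ _).trans (min_le_right _ _)).trans
      (minProb_le ((le_max_right _ _).trans (le_max_left _ _)) h)
  · exact ((min_le_left _ _).trans (min_le_left _ _)).trans
      (minProb_le ((le_max_left _ _).trans (le_max_left _ _)) ⟨hs, h⟩)

lemma progressProb_le_bad (M : Chain S (Set (Marker k))) {s : S} (hs : s ∈ M.badReach) :
    M.progressProb ≤
      M.runMeasure s {ω | ∃ a b, b ≤ M.progressRadius ∧ M.BadProgress ω a b} := by
  by_cases h : s ∈ M.badStates
  · exact ((min_le_right _ _).trans (min_le_right _ _)).trans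
      (minProb_le ((le_max_right _ _).trans (le_max_right _ _)) h)
  · exact ((min_le_right _ _).trans (min_le_left _ _)).trans
      (minProb_le ((le_max_left _ _).trans (le_max_right _ _)) ⟨hs, h⟩)

lemma progressProb_le_one (M : Chain S (Set (Marker k))) : M.progressProb ≤ 1 := by
  rcases mem_goodReach_or_badReach (M := M) M.init with h | h
  · exact (M.progressProb_le_good h).trans prob_le_one
  · exact (M.progressProb_le_bad h).trans prob_le_one

lemma runMeasure_stuck_good_le (M : Chain S (Set (Marker k))) (s : S) :
    M.runMeasure s {ω | Stuck M.goodReach M.GoodProgress ω 0 M.progressRadius} ≤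
      1 - M.progressProb :=
  runMeasure_stuck_le_of_forall M.isLocal_goodProgress (fun _ => M.progressProb_le_good) s

lemma runMeasure_stuck_bad_le (M : Chain S (Set (Marker k))) (s : S) :
    M.runMeasure s {ω | Stuck M.badReach M.BadProgress ω 0 M.progressRadius} ≤
      1 - M.progressProb :=
  runMeasure_stuck_le_of_forall M.isLocal_badProgress (fun _ => M.progressProb_le_bad) s

lemma ae_forall_exists_not_stuck_bad (hP : M.progressProb ≠ 0) (s : S) :
    ∀ᵐ ω ∂M.runMeasure s, ∀ a, ∃ b, ¬ Stuck M.badReach M.BadProgress ω a b := by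
  rw [ae_all_iff]
  intro a
  rw [ae_iff, ← nonpos_iff_eq_zero]
  have hlim : Filter.Tendsto (fun j => (1 - M.progressProb) ^ j) Filter.atTop (nhds 0) :=
    ENNReal.tendsto_pow_atTop_nhds_zero_of_lt_one
      (ENNReal.sub_lt_self ENNReal.one_ne_top one_ne_zero hP)
  refine ge_of_tendsto' hlim fun j => ?_
  have h := runMeasure_stuck_le M.isLocal_badProgress M.runMeasure_stuck_bad_le s
    (a := a) (h := M.progressRadius * j) le_rfl
  rw [Nat.mul_div_cancel_left _ M.one_le_progressRadius] at h
  refine (measure_mono fun ω hω => ?_).trans h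
  by_contra hno
  exact hω ⟨_, hno⟩

lemma probGood_le_goodReach (hP : M.progressProb ≠ 0) (t : ℕ) :
    M.probGood ≤ M.runMeasure M.init {ω | ω t ∈ M.goodReach} := by
  refine measure_mono_ae ?_
  filter_upwards [M.ae_edge M.init, ae_forall_exists_not_stuck_bad hP M.init] with ω h1 h2 h3
  exact mem_goodReach_of_rabin h1 h2 h3 t

/-- Let `g` and `a` be the probabilities of `B_γ` and `S_γ \ B_γ` at time `R * j`. Good runs almost
surely stay in `S_γ`, so `G ≤ g + a`, and at least the fraction `P` of `a` moves into `B_γ` within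
`R` steps. The error is `(1 - P) ^ j * G` and not merely `(1 - P) ^ j`, so the number of steps
needed to reach `G / 2` does not depend on `G`. -/
lemma probGood_le_goodStates (hP : M.progressProb ≠ 0) (j : ℕ) :
    M.probGood ≤ M.runMeasure M.init {ω | ω (M.progressRadius * j) ∈ M.goodStates} +
      (1 - M.progressProb) ^ j * M.probGood := by
  induction j with
  | zero => simp
  | succ j ih =>
    set R := M.progressRadius
    set P := M.progressProb
    set x := 1 - P
    set G := M.probGood
    set μ := M.runMeasure M.init
    set g := μ {ω | ω (R * j) ∈ M.goodStates}
    set a := μ {ω | ω (R * j) ∈ M.goodReach \ M.goodStates}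
    set g' := μ {ω | ω (R * (j + 1)) ∈ M.goodStates}
    have hGa : G ≤ g + a := by
      refine (probGood_le_goodReach hP (R * j)).trans ((measure_mono fun ω hω => ?_).trans
        (measure_union_le _ _))
      by_cases h : ω (R * j) ∈ M.goodStates
      · exact Or.inl h
      · exact Or.inr ⟨hω, h⟩
    have hE : MeasurableSet {ω : ℕ → S | ∃ a b, b ≤ R ∧ M.GoodProgress ω a b}ᶜ :=
      (measurableSet_exists_prog M.isLocal_goodProgress R).compl
    have hstep : g + a ≤ g' + x * a := by
      have hx := M.runMeasure_inter_shift_le (R * j) M.init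
        (A := {ω | ω (R * j) ∈ M.goodReach \ M.goodStates})
        (fun ω ω' h hω => by simpa only [Set.mem_ofPred_eq, ← h _ le_rfl] using hω)
        (fun _ hω => hω) hE fun t ht =>
          runMeasure_no_prog_le M.isLocal_goodProgress (M.progressProb_le_good ht.1)
      refine le_trans ?_ (add_le_add_right hx g')
      rw [← measure_union _ (measurableSet_coord _ _)]
      · refine le_trans (measure_mono_ae ?_) (measure_union_le _ _)
        filter_upwards [M.ae_edge M.init] with ω hω h
        rcases h with h | h
        · exact Or.inl (mem_goodStates_of_reach h (reach_of_edge hω (by nlinarith)))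
        · by_cases hg : ω (R * (j + 1)) ∈ M.goodStates
          · exact Or.inl hg
          · refine Or.inr ⟨h, ?_⟩
            rintro ⟨c, d, hd, hcd⟩
            have hcd' := M.isLocal_goodProgress.of_shift hcd
            have hreach : M.Reach (ω (R * j + d)) (ω (R * (j + 1))) :=
              reach_of_edge hω (by rw [mul_add, mul_one]; omega)
            refine hg ?_
            rcases hcd'.2 with ⟨-, h'⟩ | ⟨B, i, hB, hc, hi, -⟩
            · exact mem_goodStates_of_reach h' hreach
            · exact mem_goodStates_of_reach (mem_goodStates_of_isGoodFor hB hc hi)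
                ((reach_of_edge hω hcd'.1.le).trans hreach)
      · exact Set.disjoint_left.2 fun ω h h' => h'.2 h
    have hPx : x + P = 1 := tsub_add_cancel_of_le M.progressProb_le_one
    have hxa : x * a ≠ ∞ := ENNReal.mul_ne_top (ENNReal.sub_ne_top ENNReal.one_ne_top)
      (measure_ne_top _ _)
    have h1 : g + P * a ≤ g' := by
      rw [← ENNReal.add_le_add_iff_right hxa, add_assoc, ← add_mul, add_comm P, hPx, one_mul]
      exact hstep
    -- The induction hypothesis and `G ≤ g + a` are combined with the weights `x` and `P`.
    calc G = x * G + P * G := by rw [← add_mul, hPx, one_mul]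
      _ ≤ x * (g + x ^ j * G) + P * (g + a) := by gcongr
      _ = (x + P) * g + P * a + x ^ (j + 1) * G := by ring
      _ ≤ g' + x ^ (j + 1) * G := by
          rw [hPx, one_mul]
          gcongr

end finite

end Chain

/-! ### The restart rule: expected length and survival probability of an attempt -/

namespace Chain

variable {S : Type u} {k : ℕ} {M : Chain S (Set (Marker k))}

/-- The rule according to which `rabinStrategy` restarts the chain in an attempt with blocks of
`2 * m` steps. -/
def rabinRule (M : Chain S (Set (Marker k))) (m : ℕ) (l : List S) : Prop :=
  2 * m ∣ l.length - 1 ∧ ¬ GoodPath (secondHalf (l.map M.obs))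

lemma currentPath_map {O : Type v} (obs : S → O) (h : History S Act) :
    currentPath (h.past.map fun p => (obs p.1, p.2)) (obs h.last) =
      (h.current ++ [h.last]).map obs := by
  have (l : List (S × Act)) : ((l.map fun p => (obs p.1, p.2)).rtakeWhile
      fun p => decide (p.2 = Act.cont)).map Prod.fst =
      ((l.rtakeWhile fun p => decide (p.2 = Act.cont)).map Prod.fst).map obs := by
    simp only [List.rtakeWhile, ← List.map_reverse, List.takeWhile_map, List.map_map]
    rfl
  simp [currentPath, History.current, this]

lemma restartsBy_rabinStrategy (M : Chain S (Set (Marker k))) (f : ℕ → ℕ) :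
    RestartsBy M (rabinStrategy f) fun n => M.rabinRule (f n) := by
  classical
  intro h
  have hn : (h.past.map fun p => (M.obs p.1, p.2)).countP
      (fun p => decide (p.2 = Act.restart)) + 1 = h.attempt := by
    rw [List.countP_map]
    rfl
  simp only [actionAt, rabinStrategy, currentPath_map, hn, rabinRule, List.length_map]
  split_ifs with hc
  · exact iff_of_true rfl hc
  · exact iff_of_false (by simp) hc

/-- Checks occur at the times `2 * m * j`. For `j = 0` the path is good by the clause on short
paths, which still needs some index `i`, whence `Nonempty (Fin k)`. For `j ≥ 1` the second half has
at least two entries, so that clause is void. -/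
lemma rabinRule_prefixList_iff [Nonempty (Fin k)] {m : ℕ} (hm : 1 ≤ m) {ω : ℕ → S} {t : ℕ} :
    M.rabinRule m (prefixList ω t) ↔
      ∃ j, 1 ≤ j ∧ t = 2 * (m * j) ∧ ¬ M.GoodWindow ω (m * j) (2 * (m * j)) := by
  have hlen : (prefixList ω t).length = t + 1 := by simp [prefixList]
  have hmem (j : ℕ) (ht : t = 2 * (m * j)) (x : Set (Marker k)) :
      x ∈ secondHalf ((prefixList ω t).map M.obs) ↔
        ∃ u, m * j ≤ u ∧ u ≤ 2 * (m * j) ∧ M.obs (ω u) = x := by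
    have hhalf : (t + 1) / 2 = m * j := by omega
    simp only [secondHalf, List.length_map, hhalf, prefixList, List.map_map,
      List.mem_iff_getElem, List.length_drop, List.length_range, List.getElem_drop,
      List.getElem_map, List.getElem_range, Function.comp_apply]
    constructor
    · rintro ⟨i, hi, h⟩
      exact ⟨m * j + i, by omega, by omega, h⟩
    · rintro ⟨u, h1, h2, h⟩
      exact ⟨u - m * j, by omega, by rwa [Nat.add_sub_cancel' h1]⟩
  have hgood (j : ℕ) (ht : t = 2 * (m * j)) (hj : 1 ≤ j) :
      GoodPath (secondHalf ((prefixList ω t).map M.obs)) ↔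
        M.GoodWindow ω (m * j) (2 * (m * j)) := by
    have hlen' : ¬ (secondHalf ((prefixList ω t).map M.obs)).length ≤ 1 := by
      rw [secondHalf, List.length_drop, List.length_map, hlen]
      have : 1 ≤ m * j := Nat.mul_pos hm hj
      omega
    simp only [GoodPath, hlen', false_or, hmem j ht, GoodWindow]
    refine exists_congr fun i => and_congr ?_ ?_
    · constructor
      · rintro ⟨_, ⟨u, h1, h2, rfl⟩, h⟩
        exact ⟨u, h1, h2, h⟩
      · rintro ⟨u, h1, h2, h⟩
        exact ⟨_, ⟨u, h1, h2, rfl⟩, h⟩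
    · constructor
      · exact fun h u h1 h2 => h _ ⟨u, h1, h2, rfl⟩
      · rintro h _ ⟨u, h1, h2, rfl⟩
        exact h u h1 h2
  rw [rabinRule, hlen, Nat.add_sub_cancel]
  constructor
  · rintro ⟨⟨j, hj⟩, h⟩
    rw [mul_assoc] at hj
    rcases Nat.eq_zero_or_pos j with rfl | hj1
    · refine absurd ?_ h
      obtain ⟨i⟩ := ‹Nonempty (Fin k)›
      refine ⟨i, Or.inl ?_⟩
      rw [secondHalf, List.length_drop, List.length_map, hlen]
      omega
    · exact ⟨j, hj1, hj, fun hw => h ((hgood j hj hj1).2 hw)⟩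
  · rintro ⟨j, hj1, hj, h⟩
    exact ⟨⟨j, by rw [hj, mul_assoc]⟩, fun hw => h ((hgood j hj hj1).1 hw)⟩

/-- A period without progress that must occur if an attempt ends between the times `4 * h` and
`8 * h`. -/
def StuckSomewhere (M : Chain S (Set (Marker k))) (ω : ℕ → S) (h : ℕ) : Prop :=
  Stuck M.goodReach M.GoodProgress ω 0 h ∨ Stuck M.badReach M.BadProgress ω 0 h ∨
    Stuck M.badReach M.BadProgress ω (2 * h) (3 * h) ∨
      Stuck M.goodReach M.GoodProgress ω (3 * h) (4 * h) ∨
        Stuck M.goodReach M.GoodProgress ω (4 * h) (5 * h)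

lemma stuckSomewhere_of_window [Finite S] {ω : ℕ → S} (hω : ∀ n, M.Edge (ω n) (ω (n + 1)))
    {h n : ℕ} (hn : 2 * h ≤ n) (hn' : n ≤ 4 * h) (h1 : M.GoodWindow ω (2 * h) (2 * (2 * h)))
    (h2 : ¬ M.GoodWindow ω n (2 * n)) : M.StuckSomewhere ω h := by
  rcases stuck_of_goodWindow_of_not_goodWindow hω hn h1 h2 with h3 | h3 | h3 | h3
  · exact Or.inl (h3.mono le_rfl (by omega))
  · exact Or.inr (Or.inl (h3.mono le_rfl (by omega)))
  · exact Or.inr (Or.inr (Or.inl (h3.mono le_rfl (by omega))))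
  · rcases le_total n (3 * h) with h4 | h4
    · exact Or.inr (Or.inr (Or.inr (Or.inl (h3.mono h4 (by omega)))))
    · exact Or.inr (Or.inr (Or.inr (Or.inr (h3.mono hn' (by omega)))))

lemma stopCost_rabinRule_le [Finite S] [Nonempty (Fin k)] {m : ℕ} (hm : 1 ≤ m) {ω : ℕ → S}
    (hω : ∀ n, M.Edge (ω n) (ω (n + 1))) :
    stopCost (M.rabinRule m) 0 [] ω ≤ ((6 * m : ℕ) : ℝ≥0∞) +
      ∑' l : ℕ, {ω | M.StuckSomewhere ω (m * 2 ^ l)}.indicator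
        (fun _ => ((12 * (m * 2 ^ l) : ℕ) : ℝ≥0∞)) ω := by
  by_cases h : ∃ t, FirstStop (M.rabinRule m) [] ω t
  swap
  · rw [stopCost_of_forall_not fun t ht => h ⟨t, ht⟩]
    exact zero_le
  obtain ⟨t, ht⟩ := h
  rw [stopCost_of_firstStop ht, add_zero, List.length_nil, zero_add]
  obtain ⟨j, hj1, rfl, hj⟩ := (rabinRule_prefixList_iff hm).1 ht.1
  have hmj : 1 ≤ m * j := Nat.mul_pos hm hj1
  rcases le_or_gt j 2 with hj2 | hj2
  · refine le_add_right (Nat.cast_le.2 ?_)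
    nlinarith
  -- Dyadic scale of the failing check: with `h = m * 2 ^ l` it occurs after time `4 * h` and not
  -- after `8 * h`.
  · obtain ⟨l, hl1, hl2⟩ : ∃ l, 2 * 2 ^ l < j ∧ j ≤ 4 * 2 ^ l := by
      have h1 := Nat.pow_log_le_self 2 (x := j - 1) (by omega)
      have h2 := Nat.lt_pow_succ_log_self (b := 2) (by norm_num) (j - 1)
      have h3 : 1 ≤ Nat.log 2 (j - 1) := Nat.log_pos (by norm_num) (by omega)
      obtain ⟨l, hl⟩ := Nat.exists_eq_add_of_le' h3
      rw [hl, pow_succ] at h1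
      rw [hl, pow_succ, pow_succ] at h2
      exact ⟨l, by omega, by omega⟩
    have hpow : 1 ≤ 2 ^ l := Nat.one_le_two_pow
    -- The check at time `4 * h` precedes the first failing one, so it was passed.
    have hw : M.GoodWindow ω (2 * (m * 2 ^ l)) (2 * (2 * (m * 2 ^ l))) := by
      by_contra hno
      refine ht.2 (2 * (m * (2 * 2 ^ l))) (by nlinarith) ?_
      refine (rabinRule_prefixList_iff hm).2 ⟨2 * 2 ^ l, by omega, rfl, ?_⟩
      rwa [mul_left_comm m 2]
    have hstuck : M.StuckSomewhere ω (m * 2 ^ l) :=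
      stuckSomewhere_of_window hω (by nlinarith) (by nlinarith) hw hj
    refine le_add_left (le_trans ?_ (ENNReal.le_tsum l))
    rw [Set.indicator_of_mem (show ω ∈ {ω | M.StuckSomewhere ω (m * 2 ^ l)} from hstuck)]
    refine Nat.cast_le.2 ?_
    nlinarith

lemma setOf_stuckSomewhere (h : ℕ) : {ω | M.StuckSomewhere ω h} =
    {ω | Stuck M.goodReach M.GoodProgress ω 0 h} ∪ ({ω | Stuck M.badReach M.BadProgress ω 0 h} ∪
      ({ω | Stuck M.badReach M.BadProgress ω (2 * h) (3 * h)} ∪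
        ({ω | Stuck M.goodReach M.GoodProgress ω (3 * h) (4 * h)} ∪
          {ω | Stuck M.goodReach M.GoodProgress ω (4 * h) (5 * h)}))) := rfl

section finite

variable [Fintype S] [MeasurableSpace S] [DiscreteMeasurableSpace S]

lemma measurableSet_stuckSomewhere (M : Chain S (Set (Marker k))) (h : ℕ) :
    MeasurableSet {ω | M.StuckSomewhere ω h} := by
  have hg := M.isLocal_goodProgress
  have hb := M.isLocal_badProgress
  rw [setOf_stuckSomewhere]
  exact (measurableSet_stuck hg _ _).union ((measurableSet_stuck hb _ _).union
    ((measurableSet_stuck hb _ _).union ((measurableSet_stuck hg _ _).union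
      (measurableSet_stuck hg _ _))))

lemma runMeasure_stuckSomewhere_le (M : Chain S (Set (Marker k))) (s : S) (h : ℕ) :
    M.runMeasure s {ω | M.StuckSomewhere ω h} ≤
      5 * (1 - M.progressProb) ^ (h / M.progressRadius) := by
  have hg (a b : ℕ) (hab : a + h ≤ b) :=
    runMeasure_stuck_le M.isLocal_goodProgress M.runMeasure_stuck_good_le s hab
  have hb (a b : ℕ) (hab : a + h ≤ b) :=
    runMeasure_stuck_le M.isLocal_badProgress M.runMeasure_stuck_bad_le s hab
  set c := (1 - M.progressProb) ^ (h / M.progressRadius)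
  rw [setOf_stuckSomewhere]
  calc _ ≤ c + (c + (c + (c + c))) := by
        refine (measure_union_le _ _).trans (add_le_add (hg _ _ (by omega)) ?_)
        refine (measure_union_le _ _).trans (add_le_add (hb _ _ (by omega)) ?_)
        refine (measure_union_le _ _).trans (add_le_add (hb _ _ (by omega)) ?_)
        exact (measure_union_le _ _).trans (add_le_add (hg _ _ (by omega)) (hg _ _ (by omega)))
    _ = 5 * c := by ring

lemma stopValue_rabinRule_le [Nonempty (Fin k)] {m : ℕ} (hm : 1 ≤ m) (s : S) :
    M.stopValue (M.rabinRule m) 0 [] s ≤ 6 * m + 60 * m *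
      ∑' l : ℕ, 2 ^ l * (1 - M.progressProb) ^ (m * 2 ^ l / M.progressRadius) := by
  calc M.stopValue (M.rabinRule m) 0 [] s
      ≤ ∫⁻ ω, (((6 * m : ℕ) : ℝ≥0∞) + ∑' l : ℕ, {ω | M.StuckSomewhere ω (m * 2 ^ l)}.indicator
        (fun _ => ((12 * (m * 2 ^ l) : ℕ) : ℝ≥0∞)) ω) ∂M.runMeasure s := by
        refine lintegral_mono_ae ?_
        filter_upwards [M.ae_edge s] with ω hω
        exact stopCost_rabinRule_le hm hω
    _ = ((6 * m : ℕ) : ℝ≥0∞) + ∑' l : ℕ, ((12 * (m * 2 ^ l) : ℕ) : ℝ≥0∞) *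
          M.runMeasure s {ω | M.StuckSomewhere ω (m * 2 ^ l)} := by
        rw [lintegral_add_left measurable_const, lintegral_const, measure_univ, mul_one,
          lintegral_tsum fun l => (measurable_const.indicator
            (M.measurableSet_stuckSomewhere _)).aemeasurable]
        congr 1
        exact tsum_congr fun l => lintegral_indicator_const (M.measurableSet_stuckSomewhere _) _
    _ ≤ ((6 * m : ℕ) : ℝ≥0∞) + ∑' l : ℕ, ((12 * (m * 2 ^ l) : ℕ) : ℝ≥0∞) *
          (5 * (1 - M.progressProb) ^ (m * 2 ^ l / M.progressRadius)) := by
        gcongr with l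
        exact M.runMeasure_stuckSomewhere_le s _
    _ = _ := by
        rw [← ENNReal.tsum_mul_left]
        push_cast
        congr 1
        refine tsum_congr fun l => ?_
        ring

/-- If the second halves of the paths are long enough, an attempt is never ended with a probability
proportional to the probability of the good runs. -/
lemma runMeasure_rabinRule_le [Nonempty (Fin k)] (hP : M.progressProb ≠ 0) {m : ℕ} (hm : 1 ≤ m)
    (h : ∑' j : ℕ, (1 - M.progressProb) ^ (m * (j + 1) / M.progressRadius) ≤ 2⁻¹) :
    M.runMeasure M.init {ω | ∃ t, M.rabinRule m (prefixList ω t)} ≤ 1 - M.probGood / 4 := by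
  set x := 1 - M.progressProb
  set R := M.progressRadius
  set μ := M.runMeasure M.init
  set A : Set (ℕ → S) := {ω | ω m ∈ M.goodStates}
  set N : Set (ℕ → S) := {ω | ∃ t, M.rabinRule m (prefixList ω t)}
  have hN : MeasurableSet N := by
    rw [show N = ⋃ t, {ω | M.rabinRule m (prefixList ω t)} by ext; simp [N]]
    exact MeasurableSet.iUnion fun t => measurableSet_of_forall_le t fun ω ω' h hω => by
      simpa only [Set.mem_ofPred_eq, ← prefixList_congr h] using hω
  -- The first term of the series in `h` is already at most `1 / 2`, which is the error factor in
  -- `probGood_le_goodStates` after `m / R` rounds.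
  have hA : M.probGood / 2 ≤ μ A := by
    have h1 := probGood_le_goodStates hP (m / R)
    have h2 : x ^ (m / R) ≤ 2⁻¹ := by
      refine le_trans ?_ h
      simpa using ENNReal.le_tsum (f := fun j : ℕ => x ^ (m * (j + 1) / R)) 0
    have h3 : μ {ω | ω (R * (m / R)) ∈ M.goodStates} ≤ μ A := by
      refine measure_mono_ae ?_
      filter_upwards [M.ae_edge M.init] with ω hω h
      exact mem_goodStates_of_reach h (reach_of_edge hω (Nat.mul_div_le m R))
    have h4 : M.probGood ≤ μ A + M.probGood / 2 := by
      refine h1.trans (add_le_add h3 ?_)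
      rw [div_eq_mul_inv, mul_comm]
      gcongr
    have hfin : M.probGood / 2 ≠ ∞ :=
      ENNReal.div_ne_top (measure_ne_top _ _) two_ne_zero
    refine (ENNReal.add_le_add_iff_right hfin).1 ?_
    rwa [ENNReal.add_halves]
  -- Union bound over the checks: all windows start at time `m` or later, hence inside the good
  -- component, where a failing window means being stuck.
  have hAN : μ (A ∩ N) ≤ 2⁻¹ * μ A := by
    calc μ (A ∩ N) ≤ μ (⋃ j : ℕ, A ∩
          {ω | Stuck M.goodReach M.GoodProgress ω (m * (j + 1)) (2 * (m * (j + 1)))}) := by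
          refine measure_mono_ae ?_
          filter_upwards [M.ae_edge M.init] with ω hω h
          obtain ⟨hA, t, ht⟩ := h
          obtain ⟨j, hj1, -, hj⟩ := (rabinRule_prefixList_iff hm).1 ht
          obtain ⟨j, rfl⟩ := Nat.exists_eq_add_of_le' hj1
          exact Set.mem_iUnion.2 ⟨j, hA, stuck_good_of_not_goodWindow hω
            (mem_goodStates_of_reach hA (reach_of_edge hω (by nlinarith))) hj⟩
      _ ≤ ∑' j : ℕ, x ^ (m * (j + 1) / R) * μ A := by
          refine (measure_iUnion_le _).trans (ENNReal.tsum_le_tsum fun j => ?_)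
          exact runMeasure_inter_stuck_le M.isLocal_goodProgress M.runMeasure_stuck_good_le _
            (m := m) (fun ω ω' h hω => by simpa only [A, Set.mem_ofPred_eq, ← h _ le_rfl] using hω)
            (by nlinarith) (by omega)
      _ ≤ 2⁻¹ * μ A := by
          rw [ENNReal.tsum_mul_right]
          gcongr
  have hNc : M.probGood / 4 ≤ μ Nᶜ := by
    have h1 : μ A ≤ μ (A ∩ N) + μ Nᶜ := by
      refine (measure_mono fun ω hω => ?_).trans (measure_union_le _ _)
      by_cases h : ω ∈ N
      · exact Or.inl ⟨hω, h⟩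
      · exact Or.inr h
    have hfin : μ A / 2 ≠ ∞ := ENNReal.div_ne_top (measure_ne_top _ _) two_ne_zero
    have h2 : μ A / 2 ≤ μ Nᶜ := by
      refine (ENNReal.add_le_add_iff_left hfin).1 ?_
      rw [ENNReal.add_halves]
      refine h1.trans (add_le_add_left (hAN.trans_eq ?_) _)
      rw [div_eq_mul_inv, mul_comm]
    refine le_trans ?_ h2
    calc M.probGood / 4 = M.probGood / 2 / 2 := by
          rw [div_eq_mul_inv, div_eq_mul_inv, div_eq_mul_inv, mul_assoc,
            ← ENNReal.mul_inv (by simp) (by simp)]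
          norm_num
      _ ≤ μ A / 2 := by gcongr
  rw [← compl_compl N, prob_compl_eq_one_sub hN.compl]
  exact tsub_le_tsub_left hNc 1

end finite

end Chain

/-! ### Geometric decay -/

/-- From `1 - p ≤ exp (-p)`; rounding `h / R` down loses a factor of at most `exp p ≤ exp 1 < 3`. -/
lemma one_sub_pow_div_le {p : ℝ≥0∞} (hp : p ≤ 1) {R : ℕ} (hR : 1 ≤ R) (h : ℕ) :
    (1 - p) ^ (h / R) ≤ 3 * ENNReal.ofReal (Real.exp (-(p.toReal / R))) ^ h := by
  have hptop : p ≠ ∞ := ne_top_of_le_ne_top ENNReal.one_ne_top hp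
  set r := p.toReal
  have hr0 : 0 ≤ r := ENNReal.toReal_nonneg
  have hr1 : r ≤ 1 := by simpa [r] using ENNReal.toReal_mono ENNReal.one_ne_top hp
  have hp' : p = ENNReal.ofReal r := (ENNReal.ofReal_toReal hptop).symm
  have hR0 : (0 : ℝ) < R := by exact_mod_cast hR
  rw [hp', ← ENNReal.ofReal_one, ← ENNReal.ofReal_sub _ hr0, ← ENNReal.ofReal_pow (by linarith),
    ← ENNReal.ofReal_pow (Real.exp_nonneg _), show (3 : ℝ≥0∞) = ENNReal.ofReal 3 by simp,
    ← ENNReal.ofReal_mul (by norm_num)]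
  refine ENNReal.ofReal_le_ofReal ?_
  have hfloor : (h : ℝ) / R - 1 ≤ (h / R : ℕ) := by
    have h1 : h < R * (h / R + 1) := Nat.lt_mul_div_succ h hR
    have h2 : (h : ℝ) ≤ R * ((h / R : ℕ) + 1) := by exact_mod_cast h1.le
    rw [sub_le_iff_le_add, div_le_iff₀ hR0]
    linarith
  calc (1 - r) ^ (h / R) ≤ Real.exp (-r) ^ (h / R) := by
        exact pow_le_pow_left₀ (by linarith) (Real.one_sub_le_exp_neg r) _
    _ = Real.exp ((h / R : ℕ) * -r) := by rw [Real.exp_nat_mul]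
    _ ≤ Real.exp (1 + h * -(r / R)) := by
        refine Real.exp_le_exp.2 ?_
        have h3 := mul_le_mul_of_nonneg_right hfloor hr0
        have h4 : (h : ℝ) / R * r = h * (r / R) := by ring
        nlinarith
    _ = Real.exp 1 * Real.exp (-(r / R)) ^ h := by rw [Real.exp_add, Real.exp_nat_mul]
    _ ≤ 3 * Real.exp (-(r / R)) ^ h := by
        gcongr
        exact Real.exp_one_lt_three.le

lemma inv_one_sub_exp_le {b : ℝ} (hb : 0 < b) :
    (1 - ENNReal.ofReal (Real.exp (-b)))⁻¹ ≤ 1 + ENNReal.ofReal b⁻¹ := by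
  have h1 : b / (1 + b) ≤ 1 - Real.exp (-b) := by
    have : Real.exp (-b) ≤ (1 + b)⁻¹ := by
      rw [Real.exp_neg]
      exact inv_anti₀ (by linarith) (by linarith [Real.add_one_le_exp b])
    have h2 : b / (1 + b) = 1 - (1 + b)⁻¹ := by field_simp; ring
    linarith
  have h0 : 0 < b / (1 + b) := by positivity
  rw [← ENNReal.ofReal_one, ← ENNReal.ofReal_sub _ (Real.exp_nonneg _),
    ← ENNReal.ofReal_inv_of_pos (h0.trans_le h1), ← ENNReal.ofReal_add zero_le_one (by positivity)]
  refine ENNReal.ofReal_le_ofReal ((inv_anti₀ h0 h1).trans_eq ?_)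
  field_simp
  ring

section decay

variable {p : ℝ≥0∞} {R m : ℕ}

lemma exp_pow_eq (a : ℝ) (m : ℕ) : ENNReal.ofReal (Real.exp (-a)) ^ m =
    ENNReal.ofReal (Real.exp (-(m * a))) := by
  rw [← ENNReal.ofReal_pow (Real.exp_nonneg _), ← Real.exp_nat_mul, mul_neg]

/-- By Cauchy condensation the sum over dyadic scales is controlled by a geometric series of ratio
`exp (-m * p / R)`, whose sum is at most `1 + R / (m * p)`. -/
lemma mul_tsum_two_pow_mul_le (hp0 : p ≠ 0) (hp : p ≤ 1) (hR : 1 ≤ R) (hm : 1 ≤ m) :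
    (m : ℝ≥0∞) * ∑' l : ℕ, 2 ^ l * (1 - p) ^ (m * 2 ^ l / R) ≤ 9 * m + 6 * (R / p) := by
  have hptop : p ≠ ∞ := ne_top_of_le_ne_top ENNReal.one_ne_top hp
  have hr0 : 0 < p.toReal := ENNReal.toReal_pos hp0 hptop
  have hR0 : (0 : ℝ) < R := by exact_mod_cast hR
  have hm0 : (0 : ℝ) < m := by exact_mod_cast hm
  set a := p.toReal / R
  have ha : 0 < a := by positivity
  set z := ENNReal.ofReal (Real.exp (-(m * a)))
  have hz1 : z ≤ 1 := by
    rw [← ENNReal.ofReal_one]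
    refine ENNReal.ofReal_le_ofReal (Real.exp_le_one_iff.2 ?_)
    have := mul_pos hm0 ha
    linarith
  have hterm (l : ℕ) : (1 - p) ^ (m * l / R) ≤ 3 * z ^ l := by
    have := one_sub_pow_div_le hp hR (m * l)
    rwa [pow_mul, exp_pow_eq] at this
  have hsum : ∑' l : ℕ, 2 ^ l * (1 - p) ^ (m * 2 ^ l / R) ≤
      3 * (3 + 2 * ENNReal.ofReal (m * a)⁻¹) := by
    calc _ ≤ ∑' l : ℕ, 3 * (2 ^ l * z ^ (2 ^ l)) := by
          refine ENNReal.tsum_le_tsum fun l => ?_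
          rw [mul_left_comm]
          gcongr
          exact hterm _
      _ = 3 * ∑' l : ℕ, 2 ^ l * z ^ (2 ^ l) := ENNReal.tsum_mul_left
      _ ≤ 3 * (z ^ 1 + 2 * ∑' l : ℕ, z ^ l) := by
          gcongr
          exact ENNReal.tsum_condensed_le fun i j _ hij => pow_le_pow_right_of_le_one' hz1 hij
      _ ≤ 3 * (1 + 2 * (1 + ENNReal.ofReal (m * a)⁻¹)) := by
          rw [ENNReal.tsum_geometric, pow_one]
          gcongr
          exact inv_one_sub_exp_le (by positivity)
      _ = _ := by ring
  have hK : (m : ℝ≥0∞) * ENNReal.ofReal (m * a)⁻¹ = R / p := by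
    rw [← ENNReal.ofReal_natCast m, ← ENNReal.ofReal_mul hm0.le, mul_inv,
      mul_inv_cancel_left₀ hm0.ne', inv_div, ENNReal.ofReal_div_of_pos hr0,
      ENNReal.ofReal_toReal hptop, ENNReal.ofReal_natCast]
  calc _ ≤ (m : ℝ≥0∞) * (3 * (3 + 2 * ENNReal.ofReal (m * a)⁻¹)) := by gcongr
    _ = 9 * m + 6 * ((m : ℝ≥0∞) * ENNReal.ofReal (m * a)⁻¹) := by ring
    _ = _ := by rw [hK]

lemma tsum_one_sub_pow_le_half (hp0 : p ≠ 0) (hp : p ≤ 1) (hR : 1 ≤ R)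
    (hm : 4 * ((R : ℝ≥0∞) / p) ≤ m) :
    ∑' j : ℕ, (1 - p) ^ (m * (j + 1) / R) ≤ 2⁻¹ := by
  have hptop : p ≠ ∞ := ne_top_of_le_ne_top ENNReal.one_ne_top hp
  have hr0 : 0 < p.toReal := ENNReal.toReal_pos hp0 hptop
  have hR0 : (0 : ℝ) < R := by exact_mod_cast hR
  set a := p.toReal / R
  have hma : 4 ≤ m * a := by
    have := ENNReal.toReal_mono (ENNReal.natCast_ne_top m) hm
    simp only [ENNReal.toReal_mul, ENNReal.toReal_div, ENNReal.toReal_natCast,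
      ENNReal.toReal_ofNat] at this
    rw [← mul_div_assoc, div_le_iff₀ hr0] at this
    rw [← mul_div_assoc, le_div_iff₀ hR0]
    exact this
  set z := ENNReal.ofReal (Real.exp (-(m * a)))
  have hterm (l : ℕ) : (1 - p) ^ (m * l / R) ≤ 3 * z ^ l := by
    have := one_sub_pow_div_le hp hR (m * l)
    rwa [pow_mul, exp_pow_eq] at this
  -- The value `13` is `1 + 4 + 4 ^ 2 / 2`, a lower bound for `exp 4`.
  have hz : z ≤ ENNReal.ofReal (1 / 13) := by
    refine ENNReal.ofReal_le_ofReal ?_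
    rw [Real.exp_neg, ← one_div]
    refine one_div_le_one_div_of_le (by norm_num) ?_
    have h1 := Real.quadratic_le_exp_of_nonneg (x := m * a) (by linarith)
    nlinarith
  calc _ ≤ ∑' j : ℕ, 3 * z ^ (j + 1) := ENNReal.tsum_le_tsum fun j => hterm _
    _ = 3 * (z * (1 - z)⁻¹) := by rw [ENNReal.tsum_mul_left, ENNReal.tsum_geometric_add_one]
    _ ≤ 3 * (ENNReal.ofReal (1 / 13) * (1 + ENNReal.ofReal (1 / 4))) := by
        gcongr
        refine (inv_one_sub_exp_le (by linarith)).trans ?_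
        gcongr
        rw [← one_div]
        exact one_div_le_one_div_of_le (by norm_num) hma
    _ ≤ 2⁻¹ := by
        rw [show (3 : ℝ≥0∞) = ENNReal.ofReal 3 by simp,
          show (1 : ℝ≥0∞) = ENNReal.ofReal 1 by simp,
          show (2⁻¹ : ℝ≥0∞) = ENNReal.ofReal 2⁻¹ by
            rw [ENNReal.ofReal_inv_of_pos two_pos]; simp,
          ← ENNReal.ofReal_add (by norm_num) (by norm_num), ← ENNReal.ofReal_mul (by norm_num),
          ← ENNReal.ofReal_mul (by norm_num)]
        exact ENNReal.ofReal_le_ofReal (by norm_num)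

end decay

/-! ### Summing over the attempts -/

/-- Since `(j + 1) ^ c ≤ (j + 1) ⋯ (j + c) = c! * (j + c).choose c`, this reduces to the negative
binomial series. -/
lemma tsum_geometric_mul_pow_le {p : ℝ≥0∞} (hp0 : p ≠ 0) (hp : p ≤ 1) (c : ℕ) :
    ∑' j : ℕ, (1 - p) ^ j * ((j : ℝ≥0∞) + 1) ^ c ≤ c.factorial * p⁻¹ ^ (c + 1) := by
  have hptop : p ≠ ∞ := ne_top_of_le_ne_top ENNReal.one_ne_top hp
  set r := p.toReal
  have hr0 : 0 < r := ENNReal.toReal_pos hp0 hptop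
  have hr1 : r ≤ 1 := by simpa [r] using ENNReal.toReal_mono ENNReal.one_ne_top hp
  have hp' : p = ENNReal.ofReal r := (ENNReal.ofReal_toReal hptop).symm
  have hs := hasSum_choose_mul_geometric_of_norm_lt_one c (r := 1 - r)
    (by rw [Real.norm_eq_abs, abs_lt]; constructor <;> linarith)
  have h0 (j : ℕ) : (0 : ℝ) ≤ ((j + c).choose c : ℝ) * (1 - r) ^ j :=
    mul_nonneg (Nat.cast_nonneg _) (pow_nonneg (by linarith) _)
  have hsum : ∑' j : ℕ, (((j + c).choose c : ℕ) : ℝ≥0∞) * (1 - p) ^ j = p⁻¹ ^ (c + 1) := by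
    have h1 := ENNReal.ofReal_tsum_of_nonneg h0 hs.summable
    rw [hs.tsum_eq, sub_sub_cancel, one_div, ← inv_pow, ENNReal.ofReal_pow (by positivity),
      ENNReal.ofReal_inv_of_pos hr0, ← hp'] at h1
    rw [h1]
    refine tsum_congr fun j => ?_
    rw [ENNReal.ofReal_mul (Nat.cast_nonneg _), ENNReal.ofReal_natCast,
      ENNReal.ofReal_pow (by linarith), ENNReal.ofReal_sub _ hr0.le, ENNReal.ofReal_one, ← hp']
  rw [← hsum, ← ENNReal.tsum_mul_left]
  refine ENNReal.tsum_le_tsum fun j => ?_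
  have hle : (j + 1) ^ c ≤ c.factorial * (j + c).choose c := by
    rw [← Nat.ascFactorial_eq_factorial_mul_choose]
    exact Nat.pow_succ_le_ascFactorial _ _
  rw [← mul_assoc, mul_comm]
  gcongr
  exact_mod_cast hle

lemma add_pow_le_two_pow_mul (a b c : ℕ) : (a + b) ^ c ≤ 2 ^ c * (a ^ c + b ^ c) := by
  rcases le_total a b with h | h
  · calc (a + b) ^ c ≤ (2 * b) ^ c := Nat.pow_le_pow_left (by omega) c
      _ = 2 ^ c * b ^ c := mul_pow _ _ _
      _ ≤ _ := Nat.mul_le_mul_left _ (Nat.le_add_left _ _)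
  · calc (a + b) ^ c ≤ (2 * a) ^ c := Nat.pow_le_pow_left (by omega) c
      _ = 2 ^ c * a ^ c := mul_pow _ _ _
      _ ≤ _ := Nat.mul_le_mul_left _ (Nat.le_add_right _ _)

lemma pow_mul_le_pow_add_pow (x u : ℝ≥0∞) (c : ℕ) : x ^ c * u ≤ x ^ (c + 1) + u ^ (c + 1) := by
  rcases le_total x u with h | h
  · refine le_add_left ?_
    rw [pow_succ]
    gcongr
  · refine le_add_right ?_
    rw [pow_succ]
    gcongr

/-- If the attempts with a number below `L` are short and the later ones succeed with probability at
least `p`, then the expected total length of the attempts is bounded by powers of `L` and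
`1 / p`. -/
lemma tsum_prod_mul_le {p A : ℝ≥0∞} (hp0 : p ≠ 0) (hp : p ≤ 1) {c L : ℕ} {e q : ℕ → ℝ≥0∞}
    (he : ∀ n, e n ≤ A * ((n : ℝ≥0∞) ^ c + (L : ℝ≥0∞) ^ c)) (hq1 : ∀ n, q n ≤ 1)
    (hq : ∀ n, L ≤ n → q n ≤ 1 - p) :
    ∑' m, (∏ i ∈ Finset.range m, q (i + 1)) * e (m + 1) ≤
      A * ((2 ^ c + 3) * (c.factorial + 1) * ((L : ℝ≥0∞) ^ (c + 1) + p⁻¹ ^ (c + 1))) := by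
  set u := p⁻¹
  set l : ℝ≥0∞ := (L : ℝ≥0∞)
  rw [← Summable.sum_add_tsum_nat_add' (k := L) ENNReal.summable]
  have h1 : ∑ m ∈ Finset.range L, (∏ i ∈ Finset.range m, q (i + 1)) * e (m + 1) ≤
      A * (2 * l ^ (c + 1)) := by
    calc _ ≤ ∑ m ∈ Finset.range L, A * (2 * l ^ c) := by
          refine Finset.sum_le_sum fun m hm => ?_
          refine (mul_le_of_le_one_left' (Finset.prod_le_one' fun i _ => hq1 _)).trans ?_
          refine (he _).trans ?_
          rw [two_mul]
          gcongr
          exact Nat.cast_le.2 (Finset.mem_range.1 hm)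
      _ = _ := by
          rw [Finset.sum_const, Finset.card_range, nsmul_eq_mul]
          ring
  have h2 : ∑' j, (∏ i ∈ Finset.range (j + L), q (i + 1)) * e (j + L + 1) ≤
      A * ((2 ^ c + 1) * (l ^ c * u + c.factorial * u ^ (c + 1))) := by
    calc _ ≤ ∑' j : ℕ, A * ((2 ^ c + 1) * ((1 - p) ^ j * l ^ c + (1 - p) ^ j * (j + 1) ^ c)) := by
          refine ENNReal.tsum_le_tsum fun j => ?_
          have hprod : ∏ i ∈ Finset.range (j + L), q (i + 1) ≤ (1 - p) ^ j := by
            rw [add_comm, Finset.prod_range_add]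
            refine (mul_le_of_le_one_left' (Finset.prod_le_one' fun i _ => hq1 _)).trans ?_
            refine (Finset.prod_le_pow_card _ _ _ fun i _ => hq _ (by omega)).trans_eq ?_
            rw [Finset.card_range]
          have hpow : ((j + L + 1 : ℕ) : ℝ≥0∞) ^ c ≤ 2 ^ c * (l ^ c + (j + 1) ^ c) := by
            have := add_pow_le_two_pow_mul L (j + 1) c
            rw [show j + L + 1 = L + (j + 1) by ring]
            simp only [l]
            exact_mod_cast this
          calc _ ≤ (1 - p) ^ j * (A * (2 ^ c * (l ^ c + (j + 1) ^ c) + l ^ c)) := by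
                refine mul_le_mul' hprod ((he _).trans ?_)
                gcongr
            _ ≤ (1 - p) ^ j * (A * (2 ^ c * (l ^ c + (j + 1) ^ c) + (l ^ c + (j + 1) ^ c))) := by
                gcongr
                exact le_self_add
            _ = _ := by ring
      _ ≤ _ := by
          rw [ENNReal.tsum_mul_left, ENNReal.tsum_mul_left, ENNReal.tsum_add,
            ENNReal.tsum_mul_right, ENNReal.tsum_geometric,
            ENNReal.sub_sub_cancel ENNReal.one_ne_top hp, mul_comm p⁻¹]
          gcongr
          exact tsum_geometric_mul_pow_le hp0 hp c
  refine (add_le_add h1 h2).trans ?_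
  rw [← mul_add]
  gcongr
  have h3 := pow_mul_le_pow_add_pow l u c
  calc 2 * l ^ (c + 1) + (2 ^ c + 1) * (l ^ c * u + c.factorial * u ^ (c + 1))
      ≤ 2 * l ^ (c + 1) + (2 ^ c + 1) * (l ^ (c + 1) + u ^ (c + 1) + c.factorial * u ^ (c + 1)) := by
        gcongr
    _ ≤ 2 * l ^ (c + 1) + (2 ^ c + 1) * (l ^ (c + 1) + u ^ (c + 1) + c.factorial * u ^ (c + 1)) +
        (2 ^ c * (c.factorial * l ^ (c + 1)) + 3 * c.factorial * l ^ (c + 1) +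
          2 * u ^ (c + 1) + 2 * c.factorial * u ^ (c + 1)) := le_self_add
    _ = (2 ^ c + 3) * (c.factorial + 1) * (l ^ (c + 1) + u ^ (c + 1)) := by
        ring

/-- Take `L` to be `(4 * K) ^ (1 / c)` rounded up. As `K ≥ 1`, rounding costs at most a factor `2`;
the `16` bounds `4 ^ (1 + 1 / c)`. -/
lemma exists_nat_pow_ge {K : ℝ} (hK : 1 ≤ K) {c : ℕ} (hc : 1 ≤ c) :
    ∃ L : ℕ, 4 * K ≤ (L : ℝ) ^ c ∧
      (L : ℝ) ^ (c + 1) ≤ 2 ^ (c + 1) * 16 * K ^ (1 + 1 / (c : ℝ)) := by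
  have hc0 : (0 : ℝ) < c := by exact_mod_cast hc
  have hc1 : 1 / (c : ℝ) ≤ 1 := by
    rw [div_le_one hc0]
    exact_mod_cast hc
  set w := (4 * K) ^ (1 / (c : ℝ))
  have hw1 : 1 ≤ w := Real.one_le_rpow (by linarith) (by positivity)
  have hwc : w ^ c = 4 * K := by
    rw [← Real.rpow_natCast, ← Real.rpow_mul (by linarith), one_div_mul_cancel hc0.ne',
      Real.rpow_one]
  have hL1 : w ≤ ⌈w⌉₊ := Nat.le_ceil w
  have hL2 : (⌈w⌉₊ : ℝ) ≤ 2 * w := by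
    linarith [Nat.ceil_lt_add_one (zero_le_one.trans hw1)]
  refine ⟨⌈w⌉₊, hwc ▸ pow_le_pow_left₀ (by linarith) hL1 c, ?_⟩
  calc (⌈w⌉₊ : ℝ) ^ (c + 1) ≤ (2 * w) ^ (c + 1) := pow_le_pow_left₀ (Nat.cast_nonneg _) hL2 _
    _ = 2 ^ (c + 1) * (4 * K) ^ (1 + 1 / (c : ℝ)) := by
        rw [mul_pow, pow_succ w, hwc, Real.rpow_add (by linarith), Real.rpow_one]
    _ ≤ 2 ^ (c + 1) * (16 * K ^ (1 + 1 / (c : ℝ))) := by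
        rw [Real.mul_rpow (by norm_num) (by linarith)]
        gcongr
        calc (4 : ℝ) ^ (1 + 1 / (c : ℝ)) ≤ 4 ^ (2 : ℝ) :=
              Real.rpow_le_rpow_of_exponent_le (by norm_num) (by linarith)
          _ = 16 := by norm_num
    _ = _ := by ring

lemma exists_nat_pow_ge' {K : ℝ≥0∞} (hK : 1 ≤ K) (hK' : K ≠ ∞) {c : ℕ} (hc : 1 ≤ c) :
    ∃ L : ℕ, 4 * K ≤ (L : ℝ≥0∞) ^ c ∧
      (L : ℝ≥0∞) ^ (c + 1) ≤ 2 ^ (c + 1) * 16 * K ^ (1 + 1 / (c : ℝ)) := by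
  have h1 : 1 ≤ K.toReal := by simpa using ENNReal.toReal_mono hK' hK
  obtain ⟨L, h2, h3⟩ := exists_nat_pow_ge h1 hc
  refine ⟨L, ?_, ?_⟩
  · have := ENNReal.ofReal_le_ofReal h2
    rwa [ENNReal.ofReal_mul (by norm_num), ENNReal.ofReal_toReal hK',
      ENNReal.ofReal_pow (Nat.cast_nonneg _), ENNReal.ofReal_natCast, ENNReal.ofReal_ofNat] at this
  · have := ENNReal.ofReal_le_ofReal h3
    rwa [ENNReal.ofReal_mul (by positivity), ENNReal.ofReal_mul (by positivity),
      ENNReal.ofReal_pow (Nat.cast_nonneg _), ENNReal.ofReal_pow zero_le_two,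
      ← ENNReal.ofReal_rpow_of_pos (by linarith), ENNReal.ofReal_toReal hK', ENNReal.ofReal_natCast,
      ENNReal.ofReal_ofNat, ENNReal.ofReal_ofNat] at this

/-! ### Assembly of the bound -/

lemma nonempty_fin_of_probGood {S : Type u} {k : ℕ} [MeasurableSpace S] [DiscreteMeasurableSpace S]
    {M : Chain S (Set (Marker k))} (h : 0 < M.probGood) : Nonempty (Fin k) := by
  by_contra hk
  rw [not_nonempty_iff] at hk
  refine h.ne' ?_
  have : {ρ : ℕ → S | (fun n => M.obs (ρ n)) ∈ rabinLanguage k} = ∅ := by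
    ext ρ
    simp only [rabinLanguage, IsEmpty.exists_iff]
    rfl
  rw [Chain.probGood, this, measure_empty]

/-- The threshold `L` serves twice: for `n ≥ L` the blocks are long enough for the survival
estimate, and for every `n` the term `R / P` in the expected length is absorbed by `L ^ c`. -/
lemma expectedSteps_rabinStrategy_le {c : ℕ} {S : Type u} {k : ℕ} [Fintype S]
    [MeasurableSpace S] [DiscreteMeasurableSpace S] (M : Chain S (Set (Marker k)))
    (hG : 0 < M.probGood) (hP : M.progressProb ≠ 0) {L : ℕ}
    (hL : 4 * ((M.progressRadius : ℝ≥0∞) / M.progressProb) ≤ (L : ℝ≥0∞) ^ c) :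
    M.expectedSteps (rabinStrategy fun n => n ^ c) ≤
      600 * ((2 ^ c + 3) * (c.factorial + 1) *
        ((L : ℝ≥0∞) ^ (c + 1) + (M.probGood / 4)⁻¹ ^ (c + 1))) := by
  have hk := nonempty_fin_of_probGood hG
  have hP1 := M.progressProb_le_one
  have hR := M.one_le_progressRadius
  have hG4 : M.probGood / 4 ≤ 1 :=
    ENNReal.div_le_of_le_mul (by rw [one_mul]; exact prob_le_one.trans (by norm_num))
  set e : ℕ → ℝ≥0∞ := fun n => 600 * ((n : ℝ≥0∞) ^ c + (L : ℝ≥0∞) ^ c)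
  set q : ℕ → ℝ≥0∞ := fun n => if L ≤ n then 1 - M.probGood / 4 else 1 with hq
  refine (expectedSteps_le_tsum M (Chain.restartsBy_rabinStrategy M _) (e := e) (q := q)
    (fun n hn => ?_) fun n hn => ?_).trans (tsum_prod_mul_le (p := M.probGood / 4) (A := 600)
      (e := e) (q := q) ?_ hG4 (fun n => le_rfl) (fun n => ?_) fun n hn => ?_)
  · have hm : 1 ≤ n ^ c := Nat.one_le_pow _ _ hn
    refine (Chain.stopValue_rabinRule_le hm M.init).trans ?_
    rw [mul_assoc]
    -- Here `6 + 60 * 9 = 546` and `60 * 6 = 90 * 4`; both `546` and `90` are rounded up to `600`.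
    calc _ ≤ 6 * ((n ^ c : ℕ) : ℝ≥0∞) + 60 * (9 * ((n ^ c : ℕ) : ℝ≥0∞) +
          6 * ((M.progressRadius : ℝ≥0∞) / M.progressProb)) := by
          gcongr
          exact mul_tsum_two_pow_mul_le hP hP1 hR hm
      _ = 546 * (n : ℝ≥0∞) ^ c +
          90 * (4 * ((M.progressRadius : ℝ≥0∞) / M.progressProb)) := by
          push_cast
          ring
      _ ≤ 600 * (n : ℝ≥0∞) ^ c + 600 * (L : ℝ≥0∞) ^ c := by
          gcongr <;> norm_num
      _ = _ := by ring
  · simp only [hq]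
    split_ifs with hLn
    · refine Chain.runMeasure_rabinRule_le hP (Nat.one_le_pow _ _ hn)
        (tsum_one_sub_pow_le_half hP hP1 hR (hL.trans ?_))
      push_cast
      gcongr
    · exact prob_le_one
  · exact (ENNReal.div_pos hG.ne' (by simp)).ne'
  · simp only [hq]
    split_ifs
    · exact tsub_le_self
    · exact le_rfl
  · simp only [hq, if_pos hn, le_refl]

end BlackBox

theorem mainTheorem4 (c : ℕ) (hc : 1 ≤ c) :
    ∃ C : ℝ≥0, ∀ (k : ℕ) (S : Type*) [Fintype S] [MeasurableSpace S] [DiscreteMeasurableSpace S]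
      (M : BlackBox.Chain S (Set (BlackBox.Marker k))), 0 < M.probGood →
        M.expectedSteps (BlackBox.rabinStrategy fun n => n ^ c) ≤
          C * (((M.progressRadius : ℝ≥0∞) / M.progressProb) ^ (1 + 1 / (c : ℝ)) +
            1 / M.probGood ^ (c + 1)) := by
  -- The first factors come from summing over the attempts. In the last one, `2 ^ (c + 1) * 16`
  -- converts `L ^ (c + 1)` into the power of `R / P`, and `4 ^ (c + 1)` stems from the survival
  -- probability `G / 4`.
  refine ⟨600 * ((2 ^ c + 3) * (c.factorial + 1)) * (2 ^ (c + 1) * 16 + 4 ^ (c + 1)), ?_⟩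
  intro k S _ _ _ M hG
  have hR : (1 : ℝ≥0∞) ≤ M.progressRadius := by exact_mod_cast M.one_le_progressRadius
  by_cases hP : M.progressProb = 0
  · rw [hP, ENNReal.div_zero (zero_lt_one.trans_le hR).ne',
      ENNReal.top_rpow_of_pos (by positivity), top_add, ENNReal.mul_top]
    · exact le_top
    · rw [ENNReal.coe_ne_zero]
      positivity
  have hK1 : 1 ≤ (M.progressRadius : ℝ≥0∞) / M.progressProb :=
    hR.trans (ENNReal.le_div_iff_mul_le (Or.inl hP)
      (Or.inr (ENNReal.natCast_ne_top _)) |>.2 (mul_le_of_le_one_right' M.progressProb_le_one))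
  obtain ⟨L, hL, hL'⟩ :=
    BlackBox.exists_nat_pow_ge' hK1 (ENNReal.div_ne_top (ENNReal.natCast_ne_top _) hP) hc
  set K := (M.progressRadius : ℝ≥0∞) / M.progressProb
  refine (BlackBox.expectedSteps_rabinStrategy_le M hG hP hL).trans ?_
  have hinv : (M.probGood / 4)⁻¹ ^ (c + 1) = 4 ^ (c + 1) * (1 / M.probGood ^ (c + 1)) := by
    rw [ENNReal.inv_div (by simp) (by simp), div_eq_mul_inv, mul_pow, one_div, ENNReal.inv_pow]
  rw [hinv]
  push_cast
  set Y := 1 / M.probGood ^ (c + 1)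
  calc _ ≤ 600 * (((2 : ℝ≥0∞) ^ c + 3) * (c.factorial + 1) *
        (2 ^ (c + 1) * 16 * K ^ (1 + 1 / (c : ℝ)) + 4 ^ (c + 1) * Y)) := by gcongr
    _ ≤ 600 * (((2 : ℝ≥0∞) ^ c + 3) * (c.factorial + 1) *
        ((2 ^ (c + 1) * 16 + 4 ^ (c + 1)) * K ^ (1 + 1 / (c : ℝ)) +
          (2 ^ (c + 1) * 16 + 4 ^ (c + 1)) * Y)) := by
        gcongr
        · exact le_self_add
        · exact le_add_self
    _ = _ := by ring
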